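/- Let $W=(W^1,\dots,W^N)$ be an $N$-dimensional Brownian motion on a probability space $(\Omega,\mathcal F,P)$. Let $\Delta=\mathbb R_+\times\{1,\dots,N\}$, with points $\tau=(s,\mu)$, carry the product $d\tau$ of Lebesgue measure and counting measure, and let $\Delta_2=\{(\tau_1,\tau_2)\in\Delta^2 : s_1\le s_2\}$. For $f\in L^2(\Delta)$ let $\int_\Delta f(\tau)\,dW_\tau=\sum_\mu\int_0^\infty f(s,\mu)\,dW^\mu_s$ be the Wiener integral, and for $f\in L^2(\Delta_2)$ let $\int_{\Delta_2}f(\tau_1,\tau_2)\,dW_{\tau_1}dW_{\tau_2}$ be the iterated stochastic integral, i.e. the continuous linear map $L^2(\Delta_2)\to L^2(P)$ which sends the indicator function of $((a,b]\times\{\mu\})\times((c,d]\times\{\nu\})$, $a\le b\le c\le d$, to $(W^\mu_b-W^\mu_a)(W^\nu_d-W^\nu_c)$. All $L^2$ spaces are real. **Proposition 4.1 (exponential quadratic formula).** Let $A\in\mathbb R$, $B\in L^2(\Delta)$, and let $C\in L^2(\Delta\times\Delta)$ be symmetric, $C(\tau_1,\tau_2)=C(\tau_2,\tau_1)$ for almost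 all $(\tau_1,\tau_2)$. Denote by $C$ also the Hilbert–Schmidt operator $[Cf](\tau)=\int_\Delta C(\tau,\tau_1)f(\tau_1)\,d\tau_1$ on $L^2(\Delta)$, and assume that the spectrum of $1+C$ is contained in $(0,\infty)$. Put $$Y=A+\int_\Delta B(\tau)\,dW_\tau+\int_{\Delta_2}C(\tau_1,\tau_2)\,dW_{\tau_1}dW_{\tau_2}.$$ Then $e^{-Y}$ is integrable and $$E\left[e^{-Y}\right]=\bigl[\det\nolimits_2(1+C)\bigr]^{-1/2}\exp\Bigl[-A+\tfrac12\bigl\langle B,(1+C)^{-1}B\bigr\rangle_{L^2(\Delta)}\Bigr],$$ where $\det_2(1+C)$ is the Carleman–Fredholm determinant, i.e. the extension by continuity in the Hilbert–Schmidt norm $\|C\|_{HS}=\|C\|_{L^2(\Delta\times\Delta)}$ of $\det(1+C)\,e^{-\operatorname{Tr}C}$ from finite rank operators to Hilbert–Schmidt operators. -/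

import Mathlib

open MeasureTheory ProbabilityTheory
open scoped NNReal ENNReal

noncomputable section

namespace QuadExp

/-- The index set `Δ = ℝ₊ × {1, …, N}` of pairs `τ = (s, μ)`. -/
abbrev Idx (N : ℕ) : Type := ℝ≥0 × Fin N

/-- Lebesgue measure on `ℝ₊`. -/
def nnVolume : Measure ℝ≥0 := (volume : Measure ℝ).comap ((↑) : ℝ≥0 → ℝ)

lemma measurableEmbedding_coe : MeasurableEmbedding ((↑) : ℝ≥0 → ℝ) :=
  MeasurableEmbedding.subtype_coe measurableSet_Ici

instance : SigmaFinite nnVolume := by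
  refine SigmaFinite.of_map _ measurable_subtype_coe.aemeasurable ?_
  have h : nnVolume.map ((↑) : ℝ≥0 → ℝ) = volume.restrict (Set.range ((↑) : ℝ≥0 → ℝ)) :=
    measurableEmbedding_coe.map_comap volume
  change SigmaFinite (nnVolume.map ((↑) : ℝ≥0 → ℝ))
  rw [h]
  infer_instance

/-- The measure `dτ` on `Δ`: Lebesgue measure in `s`, counting measure in `μ`. -/
abbrev idxMeasure (N : ℕ) : Measure (Idx N) := nnVolume.prod Measure.count

/-- The real Hilbert space `L²(Δ)`. -/
abbrev L2 (N : ℕ) : Type := Lp ℝ 2 (idxMeasure N)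

/-- The square integrable kernels on `Δ × Δ`. The norm of this space is the Hilbert–Schmidt norm
of the associated integral operator. -/
abbrev Kernel2 (N : ℕ) : Type := Lp ℝ 2 ((idxMeasure N).prod (idxMeasure N))

/-- The simplex `Δ₂ = {(τ₁, τ₂) : s₁ ≤ s₂}`. -/
def simplex2 (N : ℕ) : Set (Idx N × Idx N) := {p | p.1.1 ≤ p.2.1}

/-- The real Hilbert space `L²(Δ₂)`. -/
abbrev L2Simplex (N : ℕ) : Type :=
  Lp ℝ 2 (((idxMeasure N).prod (idxMeasure N)).restrict (simplex2 N))

/-- The restriction to `Δ₂` of a kernel on `Δ × Δ`. -/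
def restrictSimplex {N : ℕ} (K : Kernel2 N) : L2Simplex N :=
  ((Lp.memLp K).restrict (simplex2 N)).toLp K

/-! ### Integral operators with square integrable kernels -/

section Operator

variable {α : Type*} [MeasurableSpace α] {m : Measure α} [SigmaFinite m]

lemma memLp_section {K : α × α → ℝ} (hK : MemLp K 2 (m.prod m)) :
    ∀ᵐ x ∂m, MemLp (fun y => K (x, y)) 2 m := by
  have h2 := (memLp_two_iff_integrable_sq hK.aestronglyMeasurable).1 hK
  filter_upwards [h2.prod_right_ae, hK.aestronglyMeasurable.prodMk_left] with x hx hm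
  exact (memLp_two_iff_integrable_sq hm).2 hx

lemma eLpNorm_two_sq {β : Type*} [MeasurableSpace β] (n : Measure β) (f : β → ℝ) :
    eLpNorm f 2 n ^ 2 = ∫⁻ x, ‖f x‖ₑ ^ 2 ∂n := by
  have := eLpNorm_nnreal_pow_eq_lintegral (f := f) (μ := n) (p := 2) (by norm_num)
  simpa using this

lemma eLpNorm_kernel_le {K : α × α → ℝ} (hK : MemLp K 2 (m.prod m)) {f : α → ℝ}
    (hf : MemLp f 2 m) :
    eLpNorm (fun x => ∫ y, K (x, y) * f y ∂m) 2 m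
      ≤ eLpNorm K 2 (m.prod m) * eLpNorm f 2 m := by
  have key : eLpNorm (fun x => ∫ y, K (x, y) * f y ∂m) 2 m ^ 2
      ≤ (eLpNorm K 2 (m.prod m) * eLpNorm f 2 m) ^ 2 := by
    rw [mul_pow, eLpNorm_two_sq, eLpNorm_two_sq (m.prod m),
      lintegral_prod _ (hK.aestronglyMeasurable.enorm.pow_const 2),
      ← lintegral_mul_const' _ _ (by simpa using hf.eLpNorm_ne_top)]
    refine lintegral_mono_ae ?_
    filter_upwards [memLp_section hK] with x hx
    rw [← eLpNorm_two_sq, ← mul_pow]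
    gcongr
    calc ‖∫ y, K (x, y) * f y ∂m‖ₑ ≤ ∫⁻ y, ‖K (x, y) * f y‖ₑ ∂m := enorm_integral_le_lintegral_enorm _
      _ = eLpNorm ((fun y => K (x, y)) • f) 1 m := by
          rw [eLpNorm_one_eq_lintegral_enorm]; rfl
      _ ≤ _ := eLpNorm_smul_le_mul_eLpNorm hf.aestronglyMeasurable hx.aestronglyMeasurable
  exact (ENNReal.pow_le_pow_left_iff two_ne_zero).1 key

lemma memLp_kernel {K : α × α → ℝ} (hK : MemLp K 2 (m.prod m)) {f : α → ℝ} (hf : MemLp f 2 m) :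
    MemLp (fun x => ∫ y, K (x, y) * f y ∂m) 2 m := by
  refine ⟨?_, (eLpNorm_kernel_le hK hf).trans_lt
    (ENNReal.mul_lt_top hK.eLpNorm_lt_top hf.eLpNorm_lt_top)⟩
  exact (hK.aestronglyMeasurable.mul hf.aestronglyMeasurable.comp_snd).integral_prod_right'

lemma integrable_kernel {K : α × α → ℝ} (hK : MemLp K 2 (m.prod m)) {f : α → ℝ}
    (hf : MemLp f 2 m) : ∀ᵐ x ∂m, Integrable (fun y => K (x, y) * f y) m := by
  filter_upwards [memLp_section hK] with x hx
  exact hx.integrable_mul hf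

/-- The Hilbert–Schmidt operator `(C f)(τ) = ∫ C(τ, τ₁) f(τ₁) dτ₁` on `L²`, for a square integrable
kernel `C`. -/
def kernelOp (K : Lp ℝ 2 (m.prod m)) : Lp ℝ 2 m →L[ℝ] Lp ℝ 2 m :=
  LinearMap.mkContinuous
    { toFun := fun f => (memLp_kernel (Lp.memLp K) (Lp.memLp f)).toLp
        (fun x => ∫ y, K (x, y) * f y ∂m)
      map_add' := by
        intro f g
        rw [← MemLp.toLp_add]
        refine MemLp.toLp_congr _ _ ?_
        filter_upwards [integrable_kernel (Lp.memLp K) (Lp.memLp f),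
          integrable_kernel (Lp.memLp K) (Lp.memLp g)] with x hf hg
        simp only [Pi.add_apply]
        rw [← integral_add hf hg]
        refine integral_congr_ae ?_
        filter_upwards [Lp.coeFn_add f g] with y hy
        rw [hy, Pi.add_apply, mul_add]
      map_smul' := by
        intro c f
        rw [RingHom.id_apply, ← MemLp.toLp_const_smul]
        refine MemLp.toLp_congr _ _ (Filter.Eventually.of_forall fun x => ?_)
        simp only [Pi.smul_apply, smul_eq_mul]
        rw [← integral_const_mul]
        refine integral_congr_ae ?_
        filter_upwards [Lp.coeFn_smul c f] with y hy
        rw [hy, Pi.smul_apply, smul_eq_mul, mul_left_comm] }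
    ‖K‖
    (by
      intro f
      change ‖(memLp_kernel (Lp.memLp K) (Lp.memLp f)).toLp _‖ ≤ _
      rw [Lp.norm_toLp, Lp.norm_def, Lp.norm_def, ← ENNReal.toReal_mul]
      exact ENNReal.toReal_mono
        (ENNReal.mul_ne_top (Lp.eLpNorm_ne_top K) (Lp.eLpNorm_ne_top f))
        (eLpNorm_kernel_le (Lp.memLp K) (Lp.memLp f)))

lemma kernelOp_apply (K : Lp ℝ 2 (m.prod m)) (f : Lp ℝ 2 m) :
    kernelOp K f =ᵐ[m] fun x => ∫ y, K (x, y) * f y ∂m :=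
  (memLp_kernel (Lp.memLp K) (Lp.memLp f)).coeFn_toLp

/-! ### The Carleman–Fredholm determinant -/

/-- `det (1 + T) · exp (-Tr T)` for a finite rank operator `T`. Determinant and trace are those
of the restrictions of `1 + T` and `T` to the finite-dimensional invariant subspace `range T`. -/
def finiteRankDet2 {H : Type*} [AddCommGroup H] [Module ℝ H] (T : H →ₗ[ℝ] H) : ℝ :=
  let S : LinearMap.range T →ₗ[ℝ] LinearMap.range T :=
    T.restrict (fun x _ => LinearMap.mem_range_self T x)
  LinearMap.det (1 + S) * Real.exp (-LinearMap.trace ℝ (LinearMap.range T) S)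

/-- The kernels of the finite rank Hilbert–Schmidt operators on `L²(m)`. -/
def finiteRankKernels (m : Measure α) [SigmaFinite m] : Set (Lp ℝ 2 (m.prod m)) :=
  {K | FiniteDimensional ℝ (LinearMap.range (kernelOp K : Lp ℝ 2 m →ₗ[ℝ] Lp ℝ 2 m))}

/-- The Carleman–Fredholm determinant `det₂ (1 + C)`: the extension by continuity, with respect to
the Hilbert–Schmidt norm, of `det (1 + C) · exp (-Tr C)` from the finite rank operators to all
Hilbert–Schmidt operators. -/
def det2 (K : Lp ℝ 2 (m.prod m)) : ℝ :=
  extendFrom (finiteRankKernels m)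
    (fun F => finiteRankDet2 (kernelOp F : Lp ℝ 2 m →ₗ[ℝ] Lp ℝ 2 m)) K

end Operator

/-! ### Brownian motion and the first two stochastic integrals -/

section Chaos

variable {Ω : Type*} [MeasurableSpace Ω] {N : ℕ}

/-- An `N`-dimensional standard Brownian motion: `N` independent one-dimensional ones. -/
structure IsBrownianMotion (W : Fin N → ℝ≥0 → Ω → ℝ) (P : Measure Ω) : Prop where
  isBrownianReal : ∀ μ, IsBrownianReal (W μ) P
  iIndepFun : iIndepFun (fun μ ω t => W μ t ω) P

/-- The graph of the Wiener integral `L²(Δ) → L²(P)`: the closed linear span of the pairs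
`(1_{(a,b] × {μ}}, W^μ_b - W^μ_a)`. -/
def wienerGraph (W : Fin N → ℝ≥0 → Ω → ℝ) (P : Measure Ω) :
    Submodule ℝ (L2 N × Lp ℝ 2 P) :=
  (Submodule.span ℝ {p : L2 N × Lp ℝ 2 P | ∃ (a b : ℝ≥0) (μ : Fin N), a ≤ b ∧
    p.1 =ᵐ[idxMeasure N] (Set.Ioc a b ×ˢ {μ}).indicator 1 ∧
    p.2 =ᵐ[P] fun ω => W μ b ω - W μ a ω}).topologicalClosure

/-- The Wiener integral `∫_Δ B(τ) dW_τ`, as an element of `L²(P)`: the continuous linear extension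
of the integral of step functions. -/
def wienerIntegral (W : Fin N → ℝ≥0 → Ω → ℝ) (P : Measure Ω) (B : L2 N) : Lp ℝ 2 P :=
  Classical.epsilon fun X => (B, X) ∈ wienerGraph W P

/-- The graph of the iterated integral `L²(Δ₂) → L²(P)`: the closed linear span of the pairs
`(1_{(a,b] × {μ}} ⊗ 1_{(c,d] × {ν}}, (W^μ_b - W^μ_a) (W^ν_d - W^ν_c))` with `a ≤ b ≤ c ≤ d`. -/
def iteratedGraph (W : Fin N → ℝ≥0 → Ω → ℝ) (P : Measure Ω) :
    Submodule ℝ (L2Simplex N × Lp ℝ 2 P) :=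
  (Submodule.span ℝ {p : L2Simplex N × Lp ℝ 2 P | ∃ (a b c d : ℝ≥0) (μ ν : Fin N),
    a ≤ b ∧ b ≤ c ∧ c ≤ d ∧
    p.1 =ᵐ[((idxMeasure N).prod (idxMeasure N)).restrict (simplex2 N)]
      ((Set.Ioc a b ×ˢ {μ}) ×ˢ (Set.Ioc c d ×ˢ {ν})).indicator 1 ∧
    p.2 =ᵐ[P] fun ω => (W μ b ω - W μ a ω) * (W ν d ω - W ν c ω)}).topologicalClosure

/-- The iterated integral `∫_{Δ₂} C(τ₁, τ₂) dW_{τ₁} dW_{τ₂}`, as an element of `L²(P)`: the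
continuous linear extension of the integral of step functions. -/
def iteratedIntegral (W : Fin N → ℝ≥0 → Ω → ℝ) (P : Measure Ω) (C : L2Simplex N) : Lp ℝ 2 P :=
  Classical.epsilon fun X => (C, X) ∈ iteratedGraph W P

/-- The random variable `Y = A + ∫_Δ B(τ) dW_τ + ∫_{Δ₂} C(τ₁, τ₂) dW_{τ₁} dW_{τ₂}`. -/
def quadVar (W : Fin N → ℝ≥0 → Ω → ℝ) (P : Measure Ω) (A : ℝ) (B : L2 N) (C : Kernel2 N)
    (ω : Ω) : ℝ :=
  A + wienerIntegral W P B ω + iteratedIntegral W P (restrictSimplex C) ω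

end Chaos

end QuadExp

end

set_option linter.unusedSectionVars false

noncomputable section

namespace QuadExp

/-! ### Totality from a π-system -/

/-! For a symmetric kernel of finite rank the formula is a finite-dimensional Gaussian computation.
Diagonalize on a finite-dimensional space containing the range of the operator and also `B`: `C = ∑
lᵢ eᵢ ⊗ eᵢ`, `B = ∑ bᵢ eᵢ` with `eᵢ` orthonormal. The Wiener integrals `xᵢ` of the `eᵢ` are
independent standard normal, and the iterated integral of `eᵢ ⊗ eᵢ` is `(xᵢ² - 1) / 2`, so `Y = A +
∑ (bᵢ xᵢ + lᵢ (xᵢ² - 1) / 2)`. The expectation factorizes into one-dimensional integrals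
(`integral_exp_quadratic_gaussianReal`); the subtracted `1` is what produces the factor `exp (-Tr
C)` of the regularized determinant. This is `integral_exp_neg_quadVar_finiteRank`.

Both stochastic integrals are read off from closed graphs. An inner product identity on generators
makes such a graph single-valued, and totality of the first components makes it everywhere defined.
For the iterated integral the identity is checked on the squares `f ⊗ f`, whose span contains the
ordered boxes by polarization (`iteratedGen_subset`).

For general `C`, positivity of the spectrum gives coercivity of `1 + C` (`exists_coercive`), which
survives small Hilbert–Schmidt perturbations. Approximate `C` by symmetric finite rank kernels `Kₙ`.
The determinants converge because, by Carleman's inequality, their logarithm is Lipschitz on the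
finite rank kernels near `C` (`rankDet2_le`, `tendsto_rankDet2`). The inverses converge because
inversion is continuous at units. The expectations converge because `exp (-Yₙ)` is bounded in `L^q`
for some `q > 1`, by the finite rank formula for the data multiplied by `q`, and converges almost
surely along a subsequence (`tendsto_integral_of_eLpNorm_le`). -/

lemma ae_eq_zero_of_setIntegral_piSystem {X : Type*} {mX : MeasurableSpace X} {n : Measure X}
    [IsFiniteMeasure n] {f : X → ℝ} (hf : Integrable f n) {S : Set (Set X)}
    (hgen : mX = MeasurableSpace.generateFrom S) (hpi : IsPiSystem S)
    (huniv : ∫ x, f x ∂n = 0) (hS : ∀ s ∈ S, ∫ x in s, f x ∂n = 0) : f =ᵐ[n] 0 := by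
  refine hf.ae_eq_zero_of_forall_setIntegral_eq_zero fun s hs _ => ?_
  induction s, hs using MeasurableSpace.induction_on_inter hgen hpi with
  | empty => simp
  | basic t ht => exact hS t ht
  | compl t ht ih =>
    have := integral_add_compl ht hf
    rw [ih (measure_lt_top _ _), huniv, zero_add] at this
    exact this
  | iUnion g hd hm ih =>
    rw [integral_iUnion hm hd hf.integrableOn]
    simp [fun i => ih i (measure_lt_top _ _)]

/-- On a set of finite measure an `L²` function is integrable, so the π-λ argument applies there.
The totality of tensor products, of step functions and of ordered boxes all follow by covering the
space, up to a null set, with countably many such sets. -/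
lemma Lp_ae_eq_zero_restrict {X : Type*} {mX : MeasurableSpace X} {n : Measure X}
    {f : Lp ℝ 2 n} {U : Set X} (hU : MeasurableSet U) (hUfin : n U ≠ ∞) {S : Set (Set X)}
    (hgen : mX = MeasurableSpace.generateFrom S) (hpi : IsPiSystem S)
    (huniv : ∫ x in U, f x ∂n = 0) (hS : ∀ s ∈ S, ∫ x in s ∩ U, f x ∂n = 0) :
    ∀ᵐ x ∂n, x ∈ U → f x = 0 := by
  rw [← ae_restrict_iff' hU]
  have : IsFiniteMeasure (n.restrict U) := ⟨by simpa [lt_top_iff_ne_top] using hUfin⟩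
  have hf : Integrable f (n.restrict U) :=
    ((Lp.memLp f).restrict U).integrable (by norm_num)
  refine ae_eq_zero_of_setIntegral_piSystem hf hgen hpi huniv fun s hs => ?_
  have hsm : MeasurableSet s := by rw [hgen]; exact MeasurableSpace.measurableSet_generateFrom hs
  rw [Measure.restrict_restrict hsm]
  exact hS s hs

/-! ### Tensor products of square integrable functions -/

section Tensor

variable {α : Type*} [MeasurableSpace α] {m : Measure α} [SigmaFinite m]

lemma memLp_tensor {f g : α → ℝ} (hf : MemLp f 2 m) (hg : MemLp g 2 m) :
    MemLp (fun p : α × α => f p.1 * g p.2) 2 (m.prod m) := by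
  have h1 := (memLp_two_iff_integrable_sq hf.aestronglyMeasurable).1 hf
  have h2 := (memLp_two_iff_integrable_sq hg.aestronglyMeasurable).1 hg
  refine (memLp_two_iff_integrable_sq
    (hf.aestronglyMeasurable.comp_fst.mul hg.aestronglyMeasurable.comp_snd)).2 ?_
  refine (h1.mul_prod h2).congr (Filter.Eventually.of_forall fun p => ?_)
  simp [mul_pow]

/-- The kernel `f ⊗ g : (x, y) ↦ f x * g y`. -/
def tensor (f g : Lp ℝ 2 m) : Lp ℝ 2 (m.prod m) :=
  (memLp_tensor (Lp.memLp f) (Lp.memLp g)).toLp _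

lemma coeFn_tensor (f g : Lp ℝ 2 m) : tensor f g =ᵐ[m.prod m] fun p => f p.1 * g p.2 :=
  MemLp.coeFn_toLp _

lemma ae_fst {p : α → Prop} (h : ∀ᵐ x ∂m, p x) : ∀ᵐ z ∂m.prod m, p z.1 :=
  Measure.quasiMeasurePreserving_fst.ae h

lemma ae_snd {p : α → Prop} (h : ∀ᵐ x ∂m, p x) : ∀ᵐ z ∂m.prod m, p z.2 :=
  Measure.quasiMeasurePreserving_snd.ae h

lemma tensor_add_left (f f' g : Lp ℝ 2 m) : tensor (f + f') g = tensor f g + tensor f' g := by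
  refine Lp.ext ?_
  filter_upwards [coeFn_tensor (f + f') g, coeFn_tensor f g, coeFn_tensor f' g,
    Lp.coeFn_add (tensor f g) (tensor f' g), ae_fst (Lp.coeFn_add f f')] with z h1 h2 h3 h4 h5
  rw [h1, h4, Pi.add_apply, h2, h3, h5, Pi.add_apply, add_mul]

lemma tensor_add_right (f g g' : Lp ℝ 2 m) : tensor f (g + g') = tensor f g + tensor f g' := by
  refine Lp.ext ?_
  filter_upwards [coeFn_tensor f (g + g'), coeFn_tensor f g, coeFn_tensor f g',
    Lp.coeFn_add (tensor f g) (tensor f g'), ae_snd (Lp.coeFn_add g g')] with z h1 h2 h3 h4 h5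
  rw [h1, h4, Pi.add_apply, h2, h3, h5, Pi.add_apply, mul_add]

lemma tensor_smul_left (c : ℝ) (f g : Lp ℝ 2 m) : tensor (c • f) g = c • tensor f g := by
  refine Lp.ext ?_
  filter_upwards [coeFn_tensor (c • f) g, coeFn_tensor f g,
    Lp.coeFn_smul c (tensor f g), ae_fst (Lp.coeFn_smul c f)] with z h1 h2 h3 h4
  rw [h1, h3, Pi.smul_apply, h2, h4, Pi.smul_apply, smul_eq_mul, smul_eq_mul, mul_assoc]

lemma tensor_smul_right (c : ℝ) (f g : Lp ℝ 2 m) : tensor f (c • g) = c • tensor f g := by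
  refine Lp.ext ?_
  filter_upwards [coeFn_tensor f (c • g), coeFn_tensor f g,
    Lp.coeFn_smul c (tensor f g), ae_snd (Lp.coeFn_smul c g)] with z h1 h2 h3 h4
  rw [h1, h3, Pi.smul_apply, h2, h4, Pi.smul_apply, smul_eq_mul, smul_eq_mul, mul_left_comm]

lemma inner_tensor (K : Lp ℝ 2 (m.prod m)) (f g : Lp ℝ 2 m) :
    inner ℝ (tensor f g) K = ∫ p, f p.1 * g p.2 * K p ∂m.prod m := by
  rw [L2.inner_def]
  refine integral_congr_ae ?_
  filter_upwards [coeFn_tensor f g] with p hp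
  simp [hp, mul_comm]

lemma inner_tensor_tensor (f g f' g' : Lp ℝ 2 m) :
    inner ℝ (tensor f g) (tensor f' g') = inner ℝ f f' * (inner ℝ g g' : ℝ) := by
  rw [inner_tensor, L2.inner_def, L2.inner_def, ← integral_prod_mul]
  refine integral_congr_ae ?_
  filter_upwards [coeFn_tensor f' g'] with p hp
  simp [hp]; ring

lemma integrable_tensor_mul (K : Lp ℝ 2 (m.prod m)) (f g : Lp ℝ 2 m) :
    Integrable (fun p => f p.1 * g p.2 * K p) (m.prod m) :=
  (memLp_tensor (Lp.memLp f) (Lp.memLp g)).integrable_mul (Lp.memLp K)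

/-- Fubini. Linearity, symmetry and Hilbert–Schmidt bounds for the operator thereby become
statements about inner products with tensors in the kernel space. -/
lemma inner_kernelOp (K : Lp ℝ 2 (m.prod m)) (f g : Lp ℝ 2 m) :
    inner ℝ f (kernelOp K g) = (inner ℝ (tensor f g) K : ℝ) := by
  rw [inner_tensor, integral_prod _ (integrable_tensor_mul K f g), L2.inner_def]
  refine integral_congr_ae ?_
  filter_upwards [kernelOp_apply K g] with x hx
  simp only [hx, RCLike.inner_apply, conj_trivial]
  rw [mul_comm, ← integral_const_mul]
  refine integral_congr_ae (Filter.Eventually.of_forall fun y => ?_)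
  simp only; ring

lemma kernelOp_tensor (f g h : Lp ℝ 2 m) : kernelOp (tensor f g) h = (inner ℝ g h : ℝ) • f := by
  refine ext_inner_left ℝ fun v => ?_
  rw [inner_kernelOp, inner_tensor_tensor, inner_smul_right, mul_comm, real_inner_comm g h]

lemma kernelOp_add (K L : Lp ℝ 2 (m.prod m)) : kernelOp (K + L) = kernelOp K + kernelOp L := by
  ext1 h
  refine ext_inner_left ℝ fun v => ?_
  simp [inner_kernelOp, inner_add_right]

lemma kernelOp_smul (c : ℝ) (K : Lp ℝ 2 (m.prod m)) : kernelOp (c • K) = c • kernelOp K := by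
  ext1 h
  refine ext_inner_left ℝ fun v => ?_
  simp [inner_kernelOp, inner_smul_right]

lemma kernelOp_sub (K L : Lp ℝ 2 (m.prod m)) : kernelOp (K - L) = kernelOp K - kernelOp L := by
  ext1 h
  refine ext_inner_left ℝ fun v => ?_
  simp [inner_kernelOp, inner_sub_right]

lemma norm_kernelOp_le (K : Lp ℝ 2 (m.prod m)) : ‖kernelOp K‖ ≤ ‖K‖ :=
  LinearMap.mkContinuous_norm_le _ (norm_nonneg _) _

/-- Tensor products are total in `L²(m ⊗ m)`. -/
lemma eq_zero_of_inner_tensor (K : Lp ℝ 2 (m.prod m))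
    (h : ∀ f g : Lp ℝ 2 m, inner ℝ (tensor f g) K = (0 : ℝ)) : K = 0 := by
  have key : ∀ A B : Set α, MeasurableSet A → MeasurableSet B → m A ≠ ∞ → m B ≠ ∞ →
      ∫ p in A ×ˢ B, K p ∂m.prod m = 0 := by
    intro A B hA hB hA' hB'
    rw [← h (indicatorConstLp 2 hA hA' 1) (indicatorConstLp 2 hB hB' 1), inner_tensor,
      ← integral_indicator (hA.prod hB)]
    refine integral_congr_ae ?_
    filter_upwards [ae_fst (indicatorConstLp_coeFn (p := 2) (hs := hA) (hμs := hA') (c := (1 : ℝ))),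
      ae_snd (indicatorConstLp_coeFn (p := 2) (hs := hB) (hμs := hB') (c := (1 : ℝ)))] with p h1 h2
    rw [h1, h2]
    by_cases h3 : p.1 ∈ A <;> by_cases h4 : p.2 ∈ B <;> simp [Set.indicator, h3, h4]
  have hfin : ∀ k A, m (A ∩ spanningSets m k) ≠ ∞ := fun k A =>
    ((measure_mono Set.inter_subset_right).trans_lt (measure_spanningSets_lt_top m k)).ne
  have hms := fun k => measurableSet_spanningSets m k
  have hz : ∀ k l : ℕ, ∀ᵐ p ∂m.prod m, p ∈ spanningSets m k ×ˢ spanningSets m l → K p = 0 := by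
    intro k l
    refine Lp_ae_eq_zero_restrict ((hms k).prod (hms l)) ?_ generateFrom_prod.symm
      isPiSystem_prod ?_ ?_
    · rw [Measure.prod_prod]
      exact ENNReal.mul_ne_top (measure_spanningSets_lt_top m k).ne
        (measure_spanningSets_lt_top m l).ne
    · exact key _ _ (hms k) (hms l) (measure_spanningSets_lt_top m k).ne
        (measure_spanningSets_lt_top m l).ne
    · rintro _ ⟨A, hA, B, hB, rfl⟩
      rw [Set.prod_inter_prod]
      exact key _ _ (hA.inter (hms k)) (hB.inter (hms l)) (hfin _ _) (hfin _ _)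
  refine (Lp.eq_zero_iff_ae_eq_zero).2 ?_
  filter_upwards [ae_all_iff.2 fun k => ae_all_iff.2 fun l => hz k l] with p hp
  obtain ⟨k, hk⟩ := Set.mem_iUnion.1 ((iUnion_spanningSets m).symm ▸ Set.mem_univ p.1)
  obtain ⟨l, hl⟩ := Set.mem_iUnion.1 ((iUnion_spanningSets m).symm ▸ Set.mem_univ p.2)
  exact hp k l ⟨hk, hl⟩

lemma mem_closure_span_tensor (K : Lp ℝ 2 (m.prod m)) :
    K ∈ closure (Submodule.span ℝ (Set.range fun p : Lp ℝ 2 m × Lp ℝ 2 m => tensor p.1 p.2) :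
      Set (Lp ℝ 2 (m.prod m))) := by
  set S := Submodule.span ℝ (Set.range fun p : Lp ℝ 2 m × Lp ℝ 2 m => tensor p.1 p.2)
  have : Sᗮ = ⊥ := by
    refine (Submodule.eq_bot_iff _).2 fun K hK => eq_zero_of_inner_tensor K fun f g => ?_
    exact (Submodule.mem_orthogonal _ _).1 hK _ (Submodule.subset_span ⟨(f, g), rfl⟩)
  rw [← Submodule.topologicalClosure_coe, Submodule.topologicalClosure_eq_top_iff.2 this]
  trivial

end Tensor

/-! ### Isometries given by their graphs -/

section Graph

variable {H K : Type*} [NormedAddCommGroup H] [InnerProductSpace ℝ H] [NormedAddCommGroup K]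
  [InnerProductSpace ℝ K]

/-- Bilinearity extends the identity to spans one argument at a time; continuity of the inner
product then extends it to closures. -/
lemma inner_eq_of_mem_closure {G : Set (H × K)}
    (hG : ∀ p ∈ G, ∀ q ∈ G, inner ℝ p.1 q.1 = (inner ℝ p.2 q.2 : ℝ)) {p q : H × K}
    (hp : p ∈ (Submodule.span ℝ G).topologicalClosure)
    (hq : q ∈ (Submodule.span ℝ G).topologicalClosure) :
    inner ℝ p.1 q.1 = (inner ℝ p.2 q.2 : ℝ) := by
  have h1 : ∀ p ∈ G, ∀ q ∈ Submodule.span ℝ G, inner ℝ p.1 q.1 = (inner ℝ p.2 q.2 : ℝ) := by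
    intro p hp q hq
    induction hq using Submodule.span_induction with
    | mem q hq => exact hG p hp q hq
    | zero => simp
    | add x y _ _ hx hy => simp [inner_add_right, hx, hy]
    | smul c x _ hx => simp [inner_smul_right, hx]
  have h2 : ∀ p ∈ Submodule.span ℝ G, ∀ q ∈ Submodule.span ℝ G,
      inner ℝ p.1 q.1 = (inner ℝ p.2 q.2 : ℝ) := by
    intro p hp q hq
    induction hp using Submodule.span_induction with
    | mem p hp => exact h1 p hp q hq
    | zero => simp
    | add x y _ _ hx hy => simp [inner_add_left, hx, hy]
    | smul c x _ hx => simp [inner_smul_left, hx]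
  have h3 : ∀ p ∈ Submodule.span ℝ G, inner ℝ p.1 q.1 = (inner ℝ p.2 q.2 : ℝ) := by
    intro p hp
    have hc : IsClosed {q : H × K | inner ℝ p.1 q.1 = (inner ℝ p.2 q.2 : ℝ)} :=
      isClosed_eq (by fun_prop) (by fun_prop)
    exact closure_minimal (fun q hq => h2 p hp q hq) hc hq
  have hc : IsClosed {p : H × K | inner ℝ p.1 q.1 = (inner ℝ p.2 q.2 : ℝ)} :=
    isClosed_eq (by fun_prop) (by fun_prop)
  exact closure_minimal (fun p hp => h3 p hp) hc hp

lemma norm_eq_of_mem_closure {G : Set (H × K)}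
    (hG : ∀ p ∈ G, ∀ q ∈ G, inner ℝ p.1 q.1 = (inner ℝ p.2 q.2 : ℝ)) {p : H × K}
    (hp : p ∈ (Submodule.span ℝ G).topologicalClosure) : ‖p.1‖ = ‖p.2‖ := by
  have := inner_eq_of_mem_closure hG hp hp
  rw [real_inner_self_eq_norm_sq, real_inner_self_eq_norm_sq] at this
  exact (sq_eq_sq₀ (norm_nonneg _) (norm_nonneg _)).1 this

/-- The difference `(0, y - z)` lies in the closed graph, and its two components have equal norms.
-/
lemma snd_eq_of_mem_closure {G : Set (H × K)}
    (hG : ∀ p ∈ G, ∀ q ∈ G, inner ℝ p.1 q.1 = (inner ℝ p.2 q.2 : ℝ)) {x : H} {y z : K}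
    (hy : (x, y) ∈ (Submodule.span ℝ G).topologicalClosure)
    (hz : (x, z) ∈ (Submodule.span ℝ G).topologicalClosure) : y = z := by
  have := norm_eq_of_mem_closure hG (Submodule.sub_mem _ hy hz)
  simp only [Prod.mk_sub_mk, sub_self, norm_zero] at this
  exact sub_eq_zero.1 (norm_eq_zero.1 this.symm)

/-- The first projection of the closed graph is isometric, so its range is complete; `htot` makes
the orthogonal complement of the range trivial. -/
lemma exists_mem_closure [CompleteSpace H] [CompleteSpace K] {G : Set (H × K)}
    (hG : ∀ p ∈ G, ∀ q ∈ G, inner ℝ p.1 q.1 = (inner ℝ p.2 q.2 : ℝ))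
    (htot : ∀ h : H, (∀ p ∈ G, inner ℝ p.1 h = (0 : ℝ)) → h = 0) (x : H) :
    ∃ y, (x, y) ∈ (Submodule.span ℝ G).topologicalClosure := by
  set E := (Submodule.span ℝ G).topologicalClosure with hE
  let φ : E →ₗᵢ[ℝ] H :=
    { toLinearMap := (LinearMap.fst ℝ H K).comp E.subtype
      norm_map' := fun p => by
        have := norm_eq_of_mem_closure hG p.2
        -- The product carries the sup norm, so equality of the two component norms is what makes
        -- the projection isometric.
        change ‖p.1.1‖ = max ‖p.1.1‖ ‖p.1.2‖
        rw [← this, max_self] }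
  have : CompleteSpace E :=
    (Submodule.isClosed_topologicalClosure _).completeSpace_coe
  have : CompleteSpace (LinearMap.range φ.toLinearMap) :=
    (φ.isometry.isClosedEmbedding.isClosed_range).completeSpace_coe
  have hbot : (LinearMap.range φ.toLinearMap)ᗮ = ⊥ := by
    refine (Submodule.eq_bot_iff _).2 fun h hh => htot h fun p hp => ?_
    refine (Submodule.mem_orthogonal _ _).1 hh _ ⟨⟨p, ?_⟩, rfl⟩
    exact Submodule.le_topologicalClosure _ (Submodule.subset_span hp)
  have htop := (Submodule.orthogonal_eq_bot_iff).1 hbot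
  have hx : x ∈ LinearMap.range φ.toLinearMap := by rw [htop]; trivial
  obtain ⟨⟨⟨a, b⟩, hp⟩, rfl⟩ := hx
  exact ⟨b, hp⟩

end Graph

/-! ### Step functions on `Δ` -/

section Step

variable {N : ℕ}

lemma nnVolume_Ioc (a b : ℝ≥0) : nnVolume (Set.Ioc a b) = ENNReal.ofReal (b - a) := by
  rw [nnVolume, measurableEmbedding_coe.comap_apply]
  have : ((↑) : ℝ≥0 → ℝ) '' Set.Ioc a b = Set.Ioc (a : ℝ) b := by
    ext x
    constructor
    · rintro ⟨y, ⟨h1, h2⟩, rfl⟩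
      exact ⟨NNReal.coe_lt_coe.2 h1, NNReal.coe_le_coe.2 h2⟩
    · rintro ⟨h1, h2⟩
      exact ⟨⟨x, a.2.trans h1.le⟩, ⟨NNReal.coe_lt_coe.1 h1, NNReal.coe_le_coe.1 h2⟩, rfl⟩
  rw [this, Real.volume_Ioc]

lemma nnVolume_singleton (a : ℝ≥0) : nnVolume {a} = 0 := by
  rw [nnVolume, measurableEmbedding_coe.comap_apply]
  simp

/-- The set `(a, b] × {μ}`. -/
def box (a b : ℝ≥0) (μ : Fin N) : Set (Idx N) := Set.Ioc a b ×ˢ {μ}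

lemma measurableSet_box (a b : ℝ≥0) (μ : Fin N) : MeasurableSet (box a b μ) :=
  measurableSet_Ioc.prod (measurableSet_singleton μ)

lemma idxMeasure_box (a b : ℝ≥0) (μ : Fin N) :
    idxMeasure N (box a b μ) = ENNReal.ofReal (b - a) := by
  rw [box, Measure.prod_prod, nnVolume_Ioc, Measure.count_singleton, mul_one]

lemma idxMeasure_box_ne_top (a b : ℝ≥0) (μ : Fin N) : idxMeasure N (box a b μ) ≠ ∞ := by
  simp [idxMeasure_box]

lemma idxMeasure_real_box_inter (a b c d : ℝ≥0) (μ ν : Fin N) :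
    (idxMeasure N).real (box a b μ ∩ box c d ν) =
      if μ = ν then max (min (b : ℝ) d - max (a : ℝ) c) 0 else 0 := by
  by_cases h : μ = ν
  · subst h
    rw [if_pos rfl, Measure.real, box, box, Set.prod_inter_prod, Set.inter_self, Set.Ioc_inter_Ioc]
    change (idxMeasure N (box _ _ μ)).toReal = _
    rw [idxMeasure_box, ENNReal.toReal_ofReal']
    push_cast
    rfl
  · rw [if_neg h, box, box, Set.prod_inter_prod]
    simp [h]

/-- The indicator function of `(a, b] × {μ}` in `L²(Δ)`. -/
def stepFun (a b : ℝ≥0) (μ : Fin N) : L2 N :=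
  indicatorConstLp 2 (measurableSet_box a b μ) (idxMeasure_box_ne_top a b μ) 1

lemma coeFn_stepFun (a b : ℝ≥0) (μ : Fin N) :
    stepFun a b μ =ᵐ[idxMeasure N] (box a b μ).indicator 1 := indicatorConstLp_coeFn

lemma inner_stepFun (a b c d : ℝ≥0) (μ ν : Fin N) :
    inner ℝ (stepFun a b μ) (stepFun c d ν) =
      if μ = ν then max (min (b : ℝ) d - max (a : ℝ) c) 0 else 0 := by
  rw [stepFun, stepFun, L2.real_inner_indicatorConstLp_one_indicatorConstLp_one
    (measurableSet_box _ _ _) (measurableSet_box _ _ _) (idxMeasure_box_ne_top _ _ _)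
    (idxMeasure_box_ne_top _ _ _), idxMeasure_real_box_inter]

lemma inner_stepFun_left (a b : ℝ≥0) (μ : Fin N) (f : L2 N) :
    inner ℝ (stepFun a b μ) f = ∫ x in box a b μ, f x ∂idxMeasure N :=
  L2.inner_indicatorConstLp_one _ _ f

/-- The sets `[0, b] × T` form a generating π-system of `Δ`. -/
def lowerSets (N : ℕ) : Set (Set (Idx N)) :=
  Set.image2 (· ×ˢ ·) (Set.range Set.Iic) Set.univ

lemma isPiSystem_lowerSets : IsPiSystem (lowerSets N) := by
  refine IsPiSystem.prod isPiSystem_Iic ?_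
  intro s _ t _ _
  trivial

lemma isCountablySpanning_Iic : IsCountablySpanning (Set.range (Set.Iic : ℝ≥0 → Set ℝ≥0)) := by
  refine ⟨fun n : ℕ => Set.Iic (n : ℝ≥0), fun n => ⟨_, rfl⟩, ?_⟩
  refine Set.eq_univ_of_forall fun x => ?_
  obtain ⟨n, hn⟩ := exists_nat_ge x
  exact Set.mem_iUnion.2 ⟨n, hn⟩

lemma generateFrom_lowerSets :
    (inferInstance : MeasurableSpace (Idx N)) = MeasurableSpace.generateFrom (lowerSets N) := by
  refine (generateFrom_eq_prod (borel_eq_generateFrom_Iic ℝ≥0 ▸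
    (BorelSpace.measurable_eq (α := ℝ≥0)).symm) ?_ isCountablySpanning_Iic
    ⟨fun _ => Set.univ, fun _ => Set.mem_univ _, Set.iUnion_const _⟩).symm
  refine le_antisymm ?_ ?_
  · exact le_top
  · intro s _
    exact MeasurableSpace.measurableSet_generateFrom trivial

/-- Cutting a box by a set of the π-system leaves a box, possibly the degenerate `(p, p]`. The
bounds on `a` and `c` keep products of boxes time-ordered after cutting; `max p q` allows for `q <
p`. -/
lemma lowerSet_inter_box (b p q : ℝ≥0) (T : Set (Fin N)) (μ : Fin N) :
    ∃ a c : ℝ≥0, p ≤ a ∧ a ≤ c ∧ c ≤ max p q ∧ (Set.Iic b ×ˢ T) ∩ box p q μ = box a c μ := by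
  by_cases h : μ ∈ T ∧ p ≤ min b q
  · refine ⟨p, min b q, le_rfl, h.2, (min_le_right _ _).trans (le_max_right _ _), ?_⟩
    ext ⟨x, ν⟩
    simp only [box, Set.mem_inter_iff, Set.mem_prod, Set.mem_Iic, Set.mem_Ioc,
      Set.mem_singleton_iff, le_min_iff]
    constructor
    · tauto
    · rintro ⟨h1, rfl⟩
      tauto
  · refine ⟨p, p, le_rfl, le_rfl, le_max_left _ _, ?_⟩
    ext ⟨x, ν⟩
    simp only [box, Set.mem_inter_iff, Set.mem_prod, Set.mem_Iic, Set.mem_Ioc,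
      Set.mem_singleton_iff]
    constructor
    · rintro ⟨⟨h1, h2⟩, ⟨h3, h4⟩, rfl⟩
      exact (h ⟨h2, le_min (h3.le.trans h1) (h3.le.trans h4)⟩).elim
    · rintro ⟨⟨h1, h2⟩, _⟩
      exact (h1.not_ge h2).elim

/-- Boxes are open on the left, so they miss time `0`, which is a null set. -/
lemma ae_exists_mem_box : ∀ᵐ x ∂idxMeasure N, ∃ (n : ℕ) (μ : Fin N), x ∈ box 0 n μ := by
  have h : ∀ᵐ s ∂nnVolume, s ≠ 0 := by
    rw [ae_iff]; simpa using nnVolume_singleton 0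
  filter_upwards [Measure.quasiMeasurePreserving_fst.ae h] with x hx
  obtain ⟨n, hn⟩ := exists_nat_ge x.1
  exact ⟨n, x.2, ⟨pos_iff_ne_zero.2 hx, hn⟩, rfl⟩

lemma eq_zero_of_inner_stepFun (f : L2 N)
    (h : ∀ a b μ, a ≤ b → inner ℝ (stepFun a b μ) f = (0 : ℝ)) : f = 0 := by
  have hz : ∀ (n : ℕ) (μ : Fin N), ∀ᵐ x ∂idxMeasure N, x ∈ box 0 n μ → f x = 0 := by
    intro n μ
    refine Lp_ae_eq_zero_restrict (measurableSet_box _ _ _) (idxMeasure_box_ne_top _ _ _)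
      generateFrom_lowerSets isPiSystem_lowerSets ?_ ?_
    · rw [← inner_stepFun_left]; exact h _ _ _ zero_le
    · rintro _ ⟨_, ⟨b, rfl⟩, T, -, rfl⟩
      obtain ⟨a, c, -, hac, -, he⟩ := lowerSet_inter_box b 0 n T μ
      change ∫ x in (Set.Iic b ×ˢ T) ∩ box 0 n μ, f x ∂_ = 0
      rw [he, ← inner_stepFun_left]
      exact h _ _ _ hac
  refine (Lp.eq_zero_iff_ae_eq_zero).2 ?_
  filter_upwards [ae_all_iff.2 fun n => ae_all_iff.2 fun μ => hz n μ, ae_exists_mem_box] with x hx hb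
  obtain ⟨n, μ, h⟩ := hb
  exact hx n μ h

end Step

/-! ### The Wiener integral -/

section Wiener

variable {Ω : Type*} [MeasurableSpace Ω] {P : Measure Ω} [IsProbabilityMeasure P] {N : ℕ}
  {W : Fin N → ℝ≥0 → Ω → ℝ}

/-- Any finite set of indices lies in `Fin N × J` for a finite set `J` of times. The components
restricted to `J` are independent Gaussian vectors, hence jointly Gaussian, and the required
marginal is a linear image. -/
lemma IsBrownianMotion.isGaussianProcess (hW : IsBrownianMotion W P) :
    IsGaussianProcess (fun i : Fin N × ℝ≥0 => W i.1 i.2) P where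
  hasGaussianLaw I := by
    classical
    let J : Finset ℝ≥0 := I.image Prod.snd
    have h1 : ∀ μ, HasGaussianLaw (fun ω => J.restrict (W μ · ω)) P := fun μ =>
      have hB := hW.isBrownianReal μ
      hB.isGaussianProcess.hasGaussianLaw J
    have h2 : ProbabilityTheory.iIndepFun (fun μ ω => J.restrict (W μ · ω)) P :=
      hW.iIndepFun.comp (fun _ => J.restrict) (fun _ => by fun_prop)
    let L : (Fin N → J → ℝ) →L[ℝ] (I → ℝ) := ContinuousLinearMap.pi fun i =>
      (ContinuousLinearMap.proj (⟨i.1.2, Finset.mem_image_of_mem _ i.2⟩ : J)).comp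
        (ContinuousLinearMap.proj (R := ℝ) (φ := fun _ : Fin N => J → ℝ) i.1.1)
    exact (ProbabilityTheory.iIndepFun.hasGaussianLaw h1 h2).map_fun L

lemma IsBrownianMotion.memLp (hW : IsBrownianMotion W P) (μ : Fin N) (a : ℝ≥0) :
    MemLp (W μ a) 2 P :=
  have hB := hW.isBrownianReal μ
  (hB.isGaussianProcess.hasGaussianLaw_eval a).memLp_two

lemma IsBrownianMotion.covariance (hW : IsBrownianMotion W P) (μ ν : Fin N) (a b : ℝ≥0) :
    cov[W μ a, W ν b; P] = if μ = ν then min (a : ℝ) b else 0 := by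
  split_ifs with h
  · subst h
    rw [(hW.isBrownianReal μ).covariance_eval, NNReal.coe_min]
  · refine IndepFun.covariance_eq_zero ?_ (hW.memLp μ a) (hW.memLp ν b)
    exact (hW.iIndepFun.indepFun h).comp (measurable_pi_apply a) (measurable_pi_apply b)

lemma IsBrownianMotion.integral_increment (hW : IsBrownianMotion W P) (μ : Fin N) (a b : ℝ≥0) :
    ∫ ω, (W μ b ω - W μ a ω) ∂P = 0 := by
  rw [integral_sub ((hW.isBrownianReal μ).integrable_eval b)
    ((hW.isBrownianReal μ).integrable_eval a), (hW.isBrownianReal μ).integral_eval,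
    (hW.isBrownianReal μ).integral_eval, sub_zero]

lemma IsBrownianMotion.integral_increment_mul (hW : IsBrownianMotion W P) (μ ν : Fin N)
    {a b c d : ℝ≥0} (hab : a ≤ b) (hcd : c ≤ d) :
    ∫ ω, (W μ b ω - W μ a ω) * (W ν d ω - W ν c ω) ∂P =
      if μ = ν then max (min (b : ℝ) d - max (a : ℝ) c) 0 else 0 := by
  have h := covariance_eq_sub ((hW.memLp μ b).sub (hW.memLp μ a))
    ((hW.memLp ν d).sub (hW.memLp ν c))
  have h0 : P[W μ b - W μ a] = 0 := hW.integral_increment μ a b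
  rw [h0, zero_mul, sub_zero, covariance_sub_left (hW.memLp _ _) (hW.memLp _ _)
    ((hW.memLp _ _).sub (hW.memLp _ _)), covariance_sub_right (hW.memLp _ _) (hW.memLp _ _)
    (hW.memLp _ _), covariance_sub_right (hW.memLp _ _) (hW.memLp _ _) (hW.memLp _ _)] at h
  simp only [hW.covariance] at h
  refine h.symm.trans ?_
  split_ifs with hμ
  · have h1 : (a : ℝ) ≤ b := hab
    have h2 : (c : ℝ) ≤ d := hcd
    -- The combination `min b d - min b c - min a d + min a c` is the length of `(a, b] ∩ (c, d]`.
    grind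
  · simp

/-- The pairs spanning the graph of the Wiener integral. -/
def wienerGen (W : Fin N → ℝ≥0 → Ω → ℝ) (P : Measure Ω) : Set (L2 N × Lp ℝ 2 P) :=
  {p | ∃ (a b : ℝ≥0) (μ : Fin N), a ≤ b ∧
    p.1 =ᵐ[idxMeasure N] (Set.Ioc a b ×ˢ {μ}).indicator 1 ∧
    p.2 =ᵐ[P] fun ω => W μ b ω - W μ a ω}

lemma stepFun_eq_iff {f : L2 N} {a b : ℝ≥0} {μ : Fin N} :
    f =ᵐ[idxMeasure N] (Set.Ioc a b ×ˢ {μ}).indicator 1 ↔ f = stepFun a b μ :=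
  ⟨fun h => Lp.ext (h.trans (coeFn_stepFun a b μ).symm), fun h => h ▸ coeFn_stepFun a b μ⟩

lemma inner_wienerGen (hW : IsBrownianMotion W P) : ∀ p ∈ wienerGen W P, ∀ q ∈ wienerGen W P,
    inner ℝ p.1 q.1 = (inner ℝ p.2 q.2 : ℝ) := by
  rintro ⟨f, X⟩ ⟨a, b, μ, hab, hf, hX⟩ ⟨g, Y⟩ ⟨c, d, ν, hcd, hg, hY⟩
  simp only at hf hX hg hY
  rw [stepFun_eq_iff.1 hf, stepFun_eq_iff.1 hg, inner_stepFun,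
    ← hW.integral_increment_mul μ ν hab hcd, L2.inner_def]
  refine integral_congr_ae ?_
  filter_upwards [hX, hY] with ω h1 h2
  simp [h1, h2, mul_comm]

/-- The increment `W^μ_b - W^μ_a` in `L²(P)`. -/
def IsBrownianMotion.incr (hW : IsBrownianMotion W P) (a b : ℝ≥0) (μ : Fin N) : Lp ℝ 2 P :=
  ((hW.memLp μ b).sub (hW.memLp μ a)).toLp (W μ b - W μ a)

lemma IsBrownianMotion.mem_wienerGen (hW : IsBrownianMotion W P) {a b : ℝ≥0} (hab : a ≤ b)
    (μ : Fin N) : (stepFun a b μ, hW.incr a b μ) ∈ wienerGen W P :=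
  ⟨a, b, μ, hab, coeFn_stepFun a b μ,
    MemLp.coeFn_toLp ((hW.memLp μ b).sub (hW.memLp μ a))⟩

/-- The choice in the definition of the integral is meaningful only once a partner is known to
exist; existence comes from the isometry on increments and the totality of step functions. -/
lemma mem_wienerGraph (hW : IsBrownianMotion W P) (f : L2 N) :
    (f, wienerIntegral W P f) ∈ wienerGraph W P :=
  Classical.epsilon_spec (exists_mem_closure (inner_wienerGen hW) (fun f hf =>
    eq_zero_of_inner_stepFun f fun _ _ μ hab => hf _ (hW.mem_wienerGen hab μ)) f)

lemma wienerIntegral_eq (hW : IsBrownianMotion W P) {f : L2 N} {X : Lp ℝ 2 P}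
    (h : (f, X) ∈ wienerGraph W P) : wienerIntegral W P f = X :=
  snd_eq_of_mem_closure (inner_wienerGen hW) (mem_wienerGraph hW f) h

lemma wienerIntegral_stepFun (hW : IsBrownianMotion W P) {a b : ℝ≥0} (hab : a ≤ b) (μ : Fin N) :
    wienerIntegral W P (stepFun a b μ) = hW.incr a b μ :=
  wienerIntegral_eq hW (Submodule.le_topologicalClosure _
    (Submodule.subset_span (hW.mem_wienerGen hab μ)))

lemma wienerIntegral_add (hW : IsBrownianMotion W P) (f g : L2 N) :
    wienerIntegral W P (f + g) = wienerIntegral W P f + wienerIntegral W P g :=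
  wienerIntegral_eq hW (Submodule.add_mem _ (mem_wienerGraph hW f) (mem_wienerGraph hW g))

lemma wienerIntegral_smul (hW : IsBrownianMotion W P) (c : ℝ) (f : L2 N) :
    wienerIntegral W P (c • f) = c • wienerIntegral W P f :=
  wienerIntegral_eq hW (Submodule.smul_mem _ c (mem_wienerGraph hW f))

lemma inner_wienerIntegral (hW : IsBrownianMotion W P) (f g : L2 N) :
    inner ℝ (wienerIntegral W P f) (wienerIntegral W P g) = (inner ℝ f g : ℝ) :=
  (inner_eq_of_mem_closure (inner_wienerGen hW) (mem_wienerGraph hW f)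
    (mem_wienerGraph hW g)).symm

/-- The Wiener integral as a linear map. -/
def wienerₗ (hW : IsBrownianMotion W P) : L2 N →ₗ[ℝ] Lp ℝ 2 P where
  toFun := wienerIntegral W P
  map_add' := wienerIntegral_add hW
  map_smul' := wienerIntegral_smul hW

@[simp] lemma wienerₗ_apply (hW : IsBrownianMotion W P) (f : L2 N) :
    wienerₗ hW f = wienerIntegral W P f := rfl

/-- Before taking closures, every second component is a centred finite combination of Brownian
values, hence Gaussian. -/
lemma exists_linear_combination (hW : IsBrownianMotion W P) {p : L2 N × Lp ℝ 2 P}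
    (hp : p ∈ Submodule.span ℝ (wienerGen W P)) :
    ∫ ω, p.2 ω ∂P = 0 ∧
    ∃ Z ∈ Submodule.span ℝ (Set.range fun i : Fin N × ℝ≥0 => W i.1 i.2), p.2 =ᵐ[P] Z := by
  have hint : ∀ X : Lp ℝ 2 P, Integrable X P := fun X => (Lp.memLp X).integrable (by norm_num)
  induction hp using Submodule.span_induction with
  | mem p hp =>
    obtain ⟨a, b, μ, -, -, h⟩ := hp
    refine ⟨(integral_congr_ae h).trans (hW.integral_increment μ a b), _, ?_, h⟩
    exact Submodule.sub_mem _ (Submodule.subset_span ⟨(μ, b), rfl⟩)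
      (Submodule.subset_span ⟨(μ, a), rfl⟩)
  | zero =>
    refine ⟨?_, 0, Submodule.zero_mem _, Lp.coeFn_zero _ _ _⟩
    exact (integral_congr_ae (Lp.coeFn_zero ℝ 2 P)).trans (by simp)
  | add x y _ _ hx hy =>
    obtain ⟨hx0, Z, hZ, hxZ⟩ := hx
    obtain ⟨hy0, Z', hZ', hyZ⟩ := hy
    refine ⟨?_, Z + Z', Submodule.add_mem _ hZ hZ', (Lp.coeFn_add x.2 y.2).trans (hxZ.add hyZ)⟩
    rw [Prod.snd_add, integral_congr_ae (Lp.coeFn_add x.2 y.2)]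
    simp only [Pi.add_apply]
    rw [integral_add (hint _) (hint _), hx0, hy0, add_zero]
  | smul c x _ hx =>
    obtain ⟨hx0, Z, hZ, hxZ⟩ := hx
    refine ⟨?_, c • Z, Submodule.smul_mem _ c hZ,
      (Lp.coeFn_smul c x.2).trans (hxZ.const_smul c)⟩
    refine (integral_congr_ae (Lp.coeFn_smul c x.2)).trans ?_
    simp only [Pi.smul_apply]
    rw [integral_smul, hx0, smul_zero]

lemma hasGaussianLaw_of_mem_span (hW : IsBrownianMotion W P) {Z : Ω → ℝ}
    (hZ : Z ∈ Submodule.span ℝ (Set.range fun i : Fin N × ℝ≥0 => W i.1 i.2)) :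
    HasGaussianLaw Z P := by
  obtain ⟨c, rfl⟩ := (Finsupp.mem_span_range_iff_exists_finsupp).1 hZ
  exact (hW.isGaussianProcess.smul c).hasGaussianLaw_sum (I := c.support)

lemma map_of_mem_span (hW : IsBrownianMotion W P) {p : L2 N × Lp ℝ 2 P}
    (hp : p ∈ Submodule.span ℝ (wienerGen W P)) :
    P.map p.2 = gaussianReal 0 (‖p.1‖ ^ 2).toNNReal := by
  obtain ⟨h0, Z, hZ, hpZ⟩ := exists_linear_combination hW hp
  have hg : HasGaussianLaw p.2 P := (hasGaussianLaw_of_mem_span hW hZ).congr hpZ.symm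
  rw [hg.map_eq_gaussianReal, h0]
  congr 2
  rw [variance_of_integral_eq_zero hg.aemeasurable h0, norm_eq_of_mem_closure (inner_wienerGen hW)
    (Submodule.le_topologicalClosure _ hp), ← real_inner_self_eq_norm_sq, L2.inner_def]
  refine integral_congr_ae (Filter.Eventually.of_forall fun ω => ?_)
  simp [sq]

lemma integral_norm_le_norm (X : Lp ℝ 2 P) : ∫ ω, ‖X ω‖ ∂P ≤ ‖X‖ := by
  rw [integral_norm_eq_lintegral_enorm (Lp.aestronglyMeasurable X), Lp.norm_def,
    ← eLpNorm_one_eq_lintegral_enorm]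
  exact ENNReal.toReal_mono (Lp.eLpNorm_ne_top X)
    (eLpNorm_le_eLpNorm_of_exponent_le (by norm_num) (Lp.aestronglyMeasurable X))

lemma norm_exp_I_sub_le (a b : ℝ) :
    ‖Complex.exp (a * Complex.I) - Complex.exp (b * Complex.I)‖ ≤ |a - b| := by
  have h : Complex.exp (a * Complex.I) - Complex.exp (b * Complex.I) =
      Complex.exp (b * Complex.I) * (Complex.exp (Complex.I * ((a - b : ℝ) : ℂ)) - 1) := by
    rw [mul_sub, ← Complex.exp_add, mul_one]
    congr 2
    push_cast
    ring
  rw [h, norm_mul, Complex.norm_exp_ofReal_mul_I, one_mul]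
  exact Real.norm_exp_I_mul_ofReal_sub_one_le

/-- Lipschitz with constant `|t|`, since `x ↦ exp (i t x)` is and the `L¹` norm is at most the `L²`
norm. This carries the Gaussian law from the span to its closure. -/
lemma continuous_integral_exp_I (t : ℝ) :
    Continuous fun X : Lp ℝ 2 P => ∫ ω, Complex.exp (t * X ω * Complex.I) ∂P := by
  have hint : ∀ X : Lp ℝ 2 P, Integrable (fun ω => Complex.exp (t * X ω * Complex.I)) P := by
    intro X
    refine Integrable.of_bound (C := 1) ?_ (Filter.Eventually.of_forall fun ω => ?_)
    · have := (Lp.aestronglyMeasurable X).aemeasurable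
      exact AEMeasurable.aestronglyMeasurable (by fun_prop)
    · have := Complex.norm_exp_ofReal_mul_I (t * X ω)
      push_cast at this
      exact this.le
  refine (LipschitzWith.of_dist_le_mul (K := ‖t‖₊) fun X Y => ?_).continuous
  rw [dist_eq_norm, dist_eq_norm, ← integral_sub (hint X) (hint Y)]
  calc _ ≤ ∫ ω, ‖Complex.exp (t * X ω * Complex.I) - Complex.exp (t * Y ω * Complex.I)‖ ∂P :=
        norm_integral_le_integral_norm _
    _ ≤ ∫ ω, |t| * ‖(X - Y : Lp ℝ 2 P) ω‖ ∂P := by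
        refine integral_mono_ae ((hint X).sub (hint Y)).norm
          (((Lp.memLp (X - Y)).integrable (by norm_num)).norm.const_mul _) ?_
        filter_upwards [Lp.coeFn_sub X Y] with ω hω
        have := norm_exp_I_sub_le (t * X ω) (t * Y ω)
        push_cast at this
        rw [hω, Pi.sub_apply, Real.norm_eq_abs, ← abs_mul, mul_sub]
        exact this
    _ ≤ _ := by
        rw [integral_const_mul]
        exact mul_le_mul_of_nonneg_left (integral_norm_le_norm _) (abs_nonneg t)

lemma charFun_map_Lp (X : Lp ℝ 2 P) (t : ℝ) :
    charFun (P.map X) t = ∫ ω, Complex.exp (t * X ω * Complex.I) ∂P := by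
  rw [charFun_apply_real, integral_map (Lp.aestronglyMeasurable X).aemeasurable (by fun_prop)]

/-- The Wiener integral of `f` has the centred normal law with variance `‖f‖²`. -/
lemma map_wienerIntegral (hW : IsBrownianMotion W P) (f : L2 N) :
    P.map (wienerIntegral W P f) = gaussianReal 0 (‖f‖ ^ 2).toNNReal := by
  have : IsProbabilityMeasure (P.map (wienerIntegral W P f)) :=
    Measure.isProbabilityMeasure_map (Lp.aestronglyMeasurable _).aemeasurable
  refine Measure.ext_of_charFun (funext fun t => ?_)
  have hform : ∀ g : L2 N, charFun (gaussianReal 0 (‖g‖ ^ 2).toNNReal) t =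
      Complex.exp (-(((‖g‖ ^ 2 : ℝ) : ℂ) * t ^ 2 / 2)) := by
    intro g
    rw [charFun_gaussianReal, Real.coe_toNNReal _ (sq_nonneg _)]
    simp
  rw [hform, charFun_map_Lp]
  -- The characteristic function identity is a closed condition on pairs, so it suffices to know it
  -- on the span of the generators.
  have hc : IsClosed {p : L2 N × Lp ℝ 2 P | ∫ ω, Complex.exp (t * p.2 ω * Complex.I) ∂P =
      Complex.exp (-(((‖p.1‖ ^ 2 : ℝ) : ℂ) * t ^ 2 / 2))} := by
    refine isClosed_eq ((continuous_integral_exp_I t).comp continuous_snd) ?_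
    fun_prop
  refine closure_minimal (fun p hp => ?_) hc (mem_wienerGraph hW f)
  change ∫ ω, Complex.exp (t * p.2 ω * Complex.I) ∂P = _
  rw [← charFun_map_Lp, map_of_mem_span hW hp, hform]

end Wiener

/-! ### The simplex -/

section Simplex

variable {N : ℕ}

lemma measurableSet_simplex2 : MeasurableSet (simplex2 N) :=
  measurableSet_le (by fun_prop) (by fun_prop)

lemma coeFn_restrictSimplex (K : Kernel2 N) :
    restrictSimplex K =ᵐ[((idxMeasure N).prod (idxMeasure N)).restrict (simplex2 N)] K :=
  MemLp.coeFn_toLp _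

lemma restrictSimplex_add (K L : Kernel2 N) :
    restrictSimplex (K + L) = restrictSimplex K + restrictSimplex L := by
  refine Lp.ext ?_
  filter_upwards [coeFn_restrictSimplex (K + L), coeFn_restrictSimplex K, coeFn_restrictSimplex L,
    Lp.coeFn_add (restrictSimplex K) (restrictSimplex L),
    ae_restrict_of_ae (Lp.coeFn_add K L)] with z h1 h2 h3 h4 h5
  rw [h1, h4, Pi.add_apply, h2, h3, h5, Pi.add_apply]

lemma restrictSimplex_smul (c : ℝ) (K : Kernel2 N) :
    restrictSimplex (c • K) = c • restrictSimplex K := by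
  refine Lp.ext ?_
  filter_upwards [coeFn_restrictSimplex (c • K), coeFn_restrictSimplex K,
    Lp.coeFn_smul c (restrictSimplex K),
    ae_restrict_of_ae (Lp.coeFn_smul c K)] with z h1 h2 h3 h4
  rw [h1, h3, Pi.smul_apply, h2, h4, Pi.smul_apply]

/-- Restriction of kernels to the simplex, as a linear map. -/
def restrictₗ (N : ℕ) : Kernel2 N →ₗ[ℝ] L2Simplex N where
  toFun := restrictSimplex
  map_add' := restrictSimplex_add
  map_smul' := restrictSimplex_smul

@[simp] lemma restrictₗ_apply (K : Kernel2 N) : restrictₗ N K = restrictSimplex K := rfl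

lemma norm_restrictSimplex_le (K : Kernel2 N) : ‖restrictSimplex K‖ ≤ ‖K‖ := by
  rw [restrictSimplex, Lp.norm_toLp, Lp.norm_def]
  exact ENNReal.toReal_mono (Lp.eLpNorm_ne_top K)
    (eLpNorm_mono_measure _ Measure.restrict_le_self)

/-- Lebesgue measure has no atoms. Hence the simplex and its transpose cover `Δ × Δ` with null
overlap, and strict or weak time order makes no difference. -/
lemma measure_diagonal :
    ((idxMeasure N).prod (idxMeasure N)) {p | p.1.1 = p.2.1} = 0 := by
  have hm : MeasurableSet {p : Idx N × Idx N | p.1.1 = p.2.1} :=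
    measurableSet_eq_fun (by fun_prop) (by fun_prop)
  refine Measure.measure_prod_null_of_ae_null hm (Filter.Eventually.of_forall fun x => ?_)
  have : Prod.mk x ⁻¹' {p : Idx N × Idx N | p.1.1 = p.2.1} = {x.1} ×ˢ Set.univ := by
    ext y
    simp [eq_comm]
  change idxMeasure N (Prod.mk x ⁻¹' {p : Idx N × Idx N | p.1.1 = p.2.1}) = 0
  rw [this, Measure.prod_prod, nnVolume_singleton, zero_mul]

/-- A symmetric function has half of its integral on the simplex. -/
lemma setIntegral_simplex2 {h : Idx N × Idx N → ℝ}
    (hi : Integrable h ((idxMeasure N).prod (idxMeasure N)))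
    (hs : ∀ᵐ p ∂(idxMeasure N).prod (idxMeasure N), h p.swap = h p) :
    ∫ p in simplex2 N, h p ∂(idxMeasure N).prod (idxMeasure N) =
      1 / 2 * ∫ p, h p ∂(idxMeasure N).prod (idxMeasure N) := by
  have h1 : ∫ p in (simplex2 N)ᶜ, h p ∂(idxMeasure N).prod (idxMeasure N) =
      ∫ p in simplex2 N, h p ∂(idxMeasure N).prod (idxMeasure N) := by
    have e1 : ((simplex2 N)ᶜ : Set _) =ᵐ[(idxMeasure N).prod (idxMeasure N)]
        Prod.swap ⁻¹' (simplex2 N) := by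
      have hd : ∀ᵐ p ∂(idxMeasure N).prod (idxMeasure N), ¬ p.1.1 = p.2.1 := by
        rw [ae_iff]; simpa using measure_diagonal
      filter_upwards [hd] with p hp
      refine propext ?_
      change ¬ (p.1.1 ≤ p.2.1) ↔ p.2.1 ≤ p.1.1
      rw [not_le]
      exact ⟨le_of_lt, fun h => lt_of_le_of_ne h (Ne.symm hp)⟩
    rw [setIntegral_congr_set e1, ← (Measure.measurePreserving_swap (μ := idxMeasure N)
      (ν := idxMeasure N)).setIntegral_preimage_emb MeasurableEquiv.prodComm.measurableEmbedding h]
    exact integral_congr_ae (ae_restrict_of_ae hs)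
  have h2 := integral_add_compl measurableSet_simplex2 hi
  rw [h1] at h2
  linarith

lemma inner_restrictSimplex (K L : Kernel2 N)
    (hK : ∀ᵐ p ∂(idxMeasure N).prod (idxMeasure N), K p.swap = K p)
    (hL : ∀ᵐ p ∂(idxMeasure N).prod (idxMeasure N), L p.swap = L p) :
    inner ℝ (restrictSimplex K) (restrictSimplex L) = (1 / 2 * inner ℝ K L : ℝ) := by
  rw [L2.inner_def, L2.inner_def, ← setIntegral_simplex2 (L2.integrable_inner K L)]
  · refine integral_congr_ae ?_
    filter_upwards [coeFn_restrictSimplex K, coeFn_restrictSimplex L] with p h1 h2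
    rw [h1, h2]
  · filter_upwards [hK, hL] with p h1 h2
    rw [h1, h2]

lemma tensor_self_swap (f : L2 N) : ∀ᵐ p ∂(idxMeasure N).prod (idxMeasure N),
    tensor f f p.swap = tensor f f p := by
  have h := coeFn_tensor f f
  filter_upwards [h, (Measure.measurePreserving_swap (μ := idxMeasure N)
      (ν := idxMeasure N)).quasiMeasurePreserving.ae h] with p h1 h2
  rw [h1, h2]
  simp [mul_comm]

/-- A rational time between `s₁ < s₂` separates the two points, so countably many ordered products
of boxes cover the simplex up to a null set. -/
lemma ae_exists_box_prod : ∀ᵐ p ∂((idxMeasure N).prod (idxMeasure N)).restrict (simplex2 N),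
    ∃ (q : ℚ) (n : ℕ) (μ ν : Fin N),
      p ∈ box 0 (Real.toNNReal q) μ ×ˢ box (Real.toNNReal q) n ν := by
  have hd : ∀ᵐ p ∂(idxMeasure N).prod (idxMeasure N), ¬ p.1.1 = p.2.1 := by
    rw [ae_iff]; simpa using measure_diagonal
  filter_upwards [ae_restrict_mem measurableSet_simplex2, ae_restrict_of_ae hd,
    ae_restrict_of_ae (ae_fst (m := idxMeasure N) ae_exists_mem_box)] with p h1 h2 h3
  obtain ⟨k, μ, hk⟩ := h3
  obtain ⟨q, -, hq1, hq2⟩ := (NNReal.lt_iff_exists_rat_btwn _ _).1 (lt_of_le_of_ne h1 h2)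
  obtain ⟨n, hn⟩ := exists_nat_ge p.2.1
  exact ⟨q, n, p.1.2, p.2.2, ⟨⟨hk.1.1, hq1.le⟩, rfl⟩, ⟨⟨hq2, hn⟩, rfl⟩⟩

lemma isPiSystem_lowerSets_prod :
    IsPiSystem (Set.image2 (· ×ˢ ·) (lowerSets N) (lowerSets N)) :=
  isPiSystem_lowerSets.prod isPiSystem_lowerSets

lemma generateFrom_lowerSets_prod :
    (inferInstance : MeasurableSpace (Idx N × Idx N)) =
      MeasurableSpace.generateFrom (Set.image2 (· ×ˢ ·) (lowerSets N) (lowerSets N)) := by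
  have h : IsCountablySpanning (lowerSets N) :=
    isCountablySpanning_Iic.prod
      ⟨fun _ => Set.univ, fun _ => Set.mem_univ _, Set.iUnion_const _⟩
  exact (generateFrom_eq_prod generateFrom_lowerSets.symm generateFrom_lowerSets.symm h h).symm

lemma eq_zero_of_setIntegral_box_prod (f : L2Simplex N)
    (h : ∀ a b c d μ ν, a ≤ b → b ≤ c → c ≤ d →
      ∫ p in box a b μ ×ˢ box c d ν, f p
        ∂((idxMeasure N).prod (idxMeasure N)).restrict (simplex2 N) = 0) : f = 0 := by
  have hz : ∀ (q : ℚ) (n : ℕ) (μ ν : Fin N),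
      ∀ᵐ p ∂((idxMeasure N).prod (idxMeasure N)).restrict (simplex2 N),
      p ∈ box 0 (Real.toNNReal q) μ ×ˢ box (Real.toNNReal q) n ν → f p = 0 := by
    intro q n μ ν
    have hA : ∀ s ∈ Set.image2 (· ×ˢ ·) (lowerSets N) (lowerSets N),
        ∫ p in s ∩ (box 0 (Real.toNNReal q) μ ×ˢ box (Real.toNNReal q) n ν), f p
          ∂((idxMeasure N).prod (idxMeasure N)).restrict (simplex2 N) = 0 := by
      rintro _ ⟨_, ⟨_, ⟨b, rfl⟩, T, -, rfl⟩, _, ⟨_, ⟨d, rfl⟩, T', -, rfl⟩, rfl⟩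
      obtain ⟨a, c, -, hac, hc, he⟩ := lowerSet_inter_box b 0 (Real.toNNReal q) T μ
      obtain ⟨a', c', ha', hac', -, he'⟩ := lowerSet_inter_box d (Real.toNNReal q) n T' ν
      simp only [Set.prod_inter_prod, he, he']
      exact h _ _ _ _ _ _ hac ((hc.trans (max_le zero_le le_rfl)).trans ha') hac'
    refine Lp_ae_eq_zero_restrict ((measurableSet_box _ _ _).prod (measurableSet_box _ _ _)) ?_
      generateFrom_lowerSets_prod isPiSystem_lowerSets_prod ?_ hA
    · refine ((Measure.restrict_apply_le _ _).trans_lt ?_).ne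
      rw [Measure.prod_prod]
      exact ENNReal.mul_lt_top (idxMeasure_box_ne_top _ _ _).lt_top
        (idxMeasure_box_ne_top _ _ _).lt_top
    · obtain hq | hq := le_total (Real.toNNReal q) n
      · exact h _ _ _ _ _ _ zero_le le_rfl hq
      · rw [show box (Real.toNNReal q) (n : ℝ≥0) ν = ∅ by simp [box, Set.Ioc_eq_empty_of_le hq]]
        simp
  refine (Lp.eq_zero_iff_ae_eq_zero).2 ?_
  filter_upwards [ae_all_iff.2 fun q => ae_all_iff.2 fun n => ae_all_iff.2 fun μ =>
    ae_all_iff.2 fun ν => hz q n μ ν, ae_exists_box_prod] with x hx hb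
  obtain ⟨q, n, μ, ν, h⟩ := hb
  exact hx q n μ ν h

end Simplex

/-! ### Fourth moments -/

lemma integral_pow_four_of_map {Ω : Type*} [MeasurableSpace Ω] {P : Measure Ω}
    [IsProbabilityMeasure P] {X : Ω → ℝ} {v : ℝ≥0} (hX : P.map X = gaussianReal 0 v) :
    ∫ ω, X ω ^ 4 ∂P = 3 * (v : ℝ) ^ 2 := by
  have hexp : integrableExpSet X P = Set.univ := by
    refine Set.eq_univ_of_forall fun t => ?_
    -- A non-integrable exponential would make the `mgf` take the default value `0`, whereas the
    -- Gaussian formula is strictly positive.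
    by_contra ht
    have h0 : mgf X P t = 0 := integral_undef ht
    rw [mgf_gaussianReal hX] at h0
    exact (Real.exp_pos _).ne' h0
  have h := iteratedDeriv_mgf_zero (X := X) (μ := P) (by rw [hexp]; simp) 4
  have hm : mgf X P = fun t => Real.exp ((v : ℝ) * t ^ 2 / 2) := by
    funext t
    rw [mgf_gaussianReal hX, zero_mul, zero_add]
  have hE : ∀ t : ℝ, HasDerivAt (fun t => Real.exp ((v : ℝ) * t ^ 2 / 2))
      (Real.exp ((v : ℝ) * t ^ 2 / 2) * (v * t)) t := by
    intro t
    have := ((hasDerivAt_pow 2 t).const_mul (v : ℝ)).div_const 2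
    convert this.exp using 1
    push_cast
    ring
  -- All derivatives of the `mgf` have the form exponential times polynomial, so four
  -- differentiations reduce to updating the polynomial.
  have hstep : ∀ (p p' : ℝ → ℝ), (∀ t, HasDerivAt p (p' t) t) →
      deriv (fun t => Real.exp ((v : ℝ) * t ^ 2 / 2) * p t) =
        fun t => Real.exp ((v : ℝ) * t ^ 2 / 2) * (v * t * p t + p' t) := by
    intro p p' hp
    funext t
    rw [((hE t).fun_mul (hp t)).deriv]
    ring
  have d1 : deriv (fun t => Real.exp ((v : ℝ) * t ^ 2 / 2)) =
      fun t => Real.exp ((v : ℝ) * t ^ 2 / 2) * (v * t) := funext fun t => (hE t).deriv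
  have q1 : ∀ t : ℝ, HasDerivAt (fun t : ℝ => (v : ℝ) * t) v t := fun t => by
    simpa using (hasDerivAt_id t).const_mul (v : ℝ)
  have q2 : ∀ t : ℝ, HasDerivAt (fun t : ℝ => (v : ℝ) * t * (v * t) + v) (2 * v ^ 2 * t) t :=
    fun t => (((q1 t).fun_mul (q1 t)).add_const (v : ℝ)).congr_deriv (by ring)
  have q3 : ∀ t : ℝ, HasDerivAt
      (fun t : ℝ => (v : ℝ) * t * ((v : ℝ) * t * (v * t) + v) + 2 * v ^ 2 * t)
      (v * ((v : ℝ) * t * (v * t) + v) + v * t * (2 * v ^ 2 * t) + 2 * v ^ 2) t :=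
    fun t => (((q1 t).fun_mul (q2 t)).fun_add
      ((hasDerivAt_id t).const_mul (2 * (v : ℝ) ^ 2))).congr_deriv (by ring)
  rw [hm, iteratedDeriv_succ', iteratedDeriv_succ', iteratedDeriv_succ', iteratedDeriv_succ',
    iteratedDeriv_zero, d1, hstep _ _ q1, hstep _ _ q2, hstep _ _ q3] at h
  simp only [Pi.pow_apply] at h
  rw [← h]
  simp
  ring

/-! ### The iterated integral -/

section Iterated

variable {Ω : Type*} [MeasurableSpace Ω] {P : Measure Ω} [IsProbabilityMeasure P] {N : ℕ}
  {W : Fin N → ℝ≥0 → Ω → ℝ}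

lemma memLp_wienerIntegral (hW : IsBrownianMotion W P) (f : L2 N) (p : ℝ≥0) :
    MemLp (wienerIntegral W P f) p P := by
  have h := memLp_id_gaussianReal (μ := 0) (v := (‖f‖ ^ 2).toNNReal) p
  rw [← map_wienerIntegral hW f] at h
  exact (memLp_map_measure_iff aestronglyMeasurable_id
    (Lp.aestronglyMeasurable _).aemeasurable).1 h

lemma integral_wienerIntegral_pow_four (hW : IsBrownianMotion W P) (f : L2 N) :
    ∫ ω, wienerIntegral W P f ω ^ 4 ∂P = 3 * ‖f‖ ^ 4 := by
  rw [integral_pow_four_of_map (map_wienerIntegral hW f), Real.coe_toNNReal _ (sq_nonneg _)]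
  ring

lemma memLp_wienerIntegral_mul (hW : IsBrownianMotion W P) (f g : L2 N) :
    MemLp (fun ω => wienerIntegral W P f ω * wienerIntegral W P g ω) 2 P := by
  have : ENNReal.HolderTriple 4 4 2 := ⟨by
    rw [← two_mul, show (4 : ℝ≥0∞) = 2 * 2 by norm_num,
      ENNReal.mul_inv (by simp) (by simp), ← mul_assoc,
      ENNReal.mul_inv_cancel (by simp) (by simp), one_mul]⟩
  exact MemLp.mul (p := 4) (q := 4) (memLp_wienerIntegral hW g 4) (memLp_wienerIntegral hW f 4)

lemma integrable_wienerIntegral_sq_mul_sq (hW : IsBrownianMotion W P) (f g : L2 N) :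
    Integrable (fun ω => wienerIntegral W P f ω ^ 2 * wienerIntegral W P g ω ^ 2) P := by
  refine ((memLp_wienerIntegral_mul hW f f).integrable_mul
    (memLp_wienerIntegral_mul hW g g)).congr (Filter.Eventually.of_forall fun ω => ?_)
  simp only [Pi.mul_apply]
  ring

/-- From `12 x² y² = (x + y)⁴ + (x - y)⁴ - 2 (x⁴ + y⁴)`: by linearity of the integral, only fourth
moments of single Gaussian variables are needed. -/
lemma integral_wienerIntegral_sq_mul_sq (hW : IsBrownianMotion W P) (f g : L2 N) :
    ∫ ω, wienerIntegral W P f ω ^ 2 * wienerIntegral W P g ω ^ 2 ∂P =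
      ‖f‖ ^ 2 * ‖g‖ ^ 2 + 2 * (inner ℝ f g : ℝ) ^ 2 := by
  have hi := integrable_wienerIntegral_sq_mul_sq hW
  have hi4 : ∀ f, Integrable (fun ω => wienerIntegral W P f ω ^ 4) P := fun f =>
    (hi f f).congr (Filter.Eventually.of_forall fun ω => by ring)
  have hsub : wienerIntegral W P (f - g) = wienerIntegral W P f - wienerIntegral W P g :=
    (wienerₗ hW).map_sub f g
  have key : ∫ ω, wienerIntegral W P f ω ^ 2 * wienerIntegral W P g ω ^ 2 ∂P =
      ∫ ω, (1 / 12) * ((wienerIntegral W P (f + g) ω ^ 4 + wienerIntegral W P (f - g) ω ^ 4) -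
        2 * (wienerIntegral W P f ω ^ 4 + wienerIntegral W P g ω ^ 4)) ∂P := by
    refine integral_congr_ae ?_
    rw [wienerIntegral_add hW, hsub]
    filter_upwards [Lp.coeFn_add (wienerIntegral W P f) (wienerIntegral W P g),
      Lp.coeFn_sub (wienerIntegral W P f) (wienerIntegral W P g)] with ω h1 h2
    rw [h1, h2, Pi.add_apply, Pi.sub_apply]
    ring
  have hi8 : ∀ f g, Integrable (fun ω => wienerIntegral W P f ω ^ 4 +
      wienerIntegral W P g ω ^ 4) P := fun f g => (hi4 f).add (hi4 g)
  rw [key, integral_const_mul, integral_sub (hi8 _ _) ((hi8 _ _).const_mul 2), integral_add (hi4 _) (hi4 _), integral_const_mul,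
    integral_add (hi4 _) (hi4 _)]
  simp only [integral_wienerIntegral_pow_four hW]
  have e1 := norm_add_sq_real f g
  have e2 := norm_sub_sq_real f g
  rw [show ‖f + g‖ ^ 4 = (‖f + g‖ ^ 2) ^ 2 by ring, show ‖f - g‖ ^ 4 = (‖f - g‖ ^ 2) ^ 2 by ring,
    e1, e2]
  ring

lemma integral_wienerIntegral_sq (hW : IsBrownianMotion W P) (f : L2 N) :
    ∫ ω, wienerIntegral W P f ω ^ 2 ∂P = ‖f‖ ^ 2 := by
  rw [← real_inner_self_eq_norm_sq, ← inner_wienerIntegral hW, L2.inner_def]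
  refine integral_congr_ae (Filter.Eventually.of_forall fun ω => ?_)
  simp [sq]

lemma memLp_wick (hW : IsBrownianMotion W P) (f g : L2 N) :
    MemLp (fun ω => wienerIntegral W P f ω * wienerIntegral W P g ω - inner ℝ f g) 2 P :=
  (memLp_wienerIntegral_mul hW f g).sub (memLp_const _)

/-- The Wick product `I(f) I(g) - ⟨f, g⟩` of two Wiener integrals. -/
def wick (hW : IsBrownianMotion W P) (f g : L2 N) : Lp ℝ 2 P := (memLp_wick hW f g).toLp _

lemma coeFn_wick (hW : IsBrownianMotion W P) (f g : L2 N) : wick hW f g =ᵐ[P]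
    fun ω => wienerIntegral W P f ω * wienerIntegral W P g ω - inner ℝ f g :=
  MemLp.coeFn_toLp _

lemma inner_wick_self (hW : IsBrownianMotion W P) (f g : L2 N) :
    inner ℝ (wick hW f f) (wick hW g g) = 2 * (inner ℝ f g : ℝ) ^ 2 := by
  have hi := integrable_wienerIntegral_sq_mul_sq hW f g
  have hi2 : ∀ f, Integrable (fun ω => wienerIntegral W P f ω ^ 2) P := fun f =>
    (Lp.memLp _).integrable_sq
  have key : inner ℝ (wick hW f f) (wick hW g g) =
      ∫ ω, ((wienerIntegral W P f ω ^ 2 * wienerIntegral W P g ω ^ 2 -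
        ‖g‖ ^ 2 * wienerIntegral W P f ω ^ 2) - (‖f‖ ^ 2 * wienerIntegral W P g ω ^ 2 -
        ‖f‖ ^ 2 * ‖g‖ ^ 2)) ∂P := by
    rw [L2.inner_def]
    refine integral_congr_ae ?_
    filter_upwards [coeFn_wick hW f f, coeFn_wick hW g g] with ω h1 h2
    rw [h1, h2, real_inner_self_eq_norm_sq, real_inner_self_eq_norm_sq]
    simp only [RCLike.inner_apply, conj_trivial]
    ring
  have h1 : Integrable (fun ω => wienerIntegral W P f ω ^ 2 * wienerIntegral W P g ω ^ 2 -
      ‖g‖ ^ 2 * wienerIntegral W P f ω ^ 2) P := hi.sub ((hi2 _).const_mul _)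
  have h2 : Integrable (fun ω => ‖f‖ ^ 2 * wienerIntegral W P g ω ^ 2 - ‖f‖ ^ 2 * ‖g‖ ^ 2) P :=
    ((hi2 _).const_mul _).sub (integrable_const _)
  rw [key, integral_sub h1 h2, integral_sub hi ((hi2 _).const_mul _),
    integral_sub ((hi2 _).const_mul _) (integrable_const _), integral_const_mul,
    integral_const_mul, integral_wienerIntegral_sq_mul_sq hW, integral_wienerIntegral_sq hW,
    integral_wienerIntegral_sq hW]
  simp
  ring

/-- The pairs `(f ⊗ f, (I(f)² - ‖f‖²) / 2)`. -/
def squareGen (hW : IsBrownianMotion W P) : Set (L2Simplex N × Lp ℝ 2 P) :=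
  Set.range fun f => (restrictSimplex (tensor f f), (1 / 2 : ℝ) • wick hW f f)

/-- Both sides are `⟨f, g⟩² / 2`: on the left because the simplex carries half of a symmetric
integral, on the right as `(1 / 2)²` times `2 ⟨f, g⟩²`. -/
lemma inner_squareGen (hW : IsBrownianMotion W P) : ∀ p ∈ squareGen hW, ∀ q ∈ squareGen hW,
    inner ℝ p.1 q.1 = (inner ℝ p.2 q.2 : ℝ) := by
  rintro _ ⟨f, rfl⟩ _ ⟨g, rfl⟩
  simp only
  rw [inner_restrictSimplex _ _ (tensor_self_swap f) (tensor_self_swap g), inner_tensor_tensor,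
    inner_smul_left, inner_smul_right, inner_wick_self]
  simp
  ring

/-- Polarization: subtract the generators for `f` and `g` from the one for `f + g`. -/
lemma sym_mem_span_squareGen (hW : IsBrownianMotion W P) (f g : L2 N) :
    (restrictSimplex (tensor f g + tensor g f), wick hW f g) ∈
      Submodule.span ℝ (squareGen hW) := by
  have hm : ∀ f, (restrictSimplex (tensor f f), (1 / 2 : ℝ) • wick hW f f) ∈
      Submodule.span ℝ (squareGen hW) := fun f => Submodule.subset_span ⟨f, rfl⟩
  have h := Submodule.sub_mem _ (Submodule.sub_mem _ (hm (f + g)) (hm f)) (hm g)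
  convert h using 1
  refine Prod.ext ?_ ?_
  · simp only [Prod.fst_sub, ← restrictₗ_apply, ← map_sub]
    congr 1
    rw [tensor_add_left, tensor_add_right, tensor_add_right]
    abel
  · simp only [Prod.snd_sub, ← smul_sub]
    refine Lp.ext ?_
    filter_upwards [coeFn_wick hW f g, coeFn_wick hW f f, coeFn_wick hW g g,
      coeFn_wick hW (f + g) (f + g), Lp.coeFn_smul (1 / 2 : ℝ)
        (wick hW (f + g) (f + g) - wick hW f f - wick hW g g),
      Lp.coeFn_sub (wick hW (f + g) (f + g) - wick hW f f) (wick hW g g),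
      Lp.coeFn_sub (wick hW (f + g) (f + g)) (wick hW f f),
      Lp.coeFn_add (wienerIntegral W P f) (wienerIntegral W P g)] with ω h1 h2 h3 h4 h5 h6 h7 h8
    rw [h5, Pi.smul_apply, h6, Pi.sub_apply, h7, Pi.sub_apply, h1, h2, h3, h4,
      wienerIntegral_add hW, h8, Pi.add_apply, inner_add_left, inner_add_right, inner_add_right,
      real_inner_comm f g, smul_eq_mul]
    ring

/-- The pairs spanning the graph of the iterated integral. -/
def iteratedGen (W : Fin N → ℝ≥0 → Ω → ℝ) (P : Measure Ω) : Set (L2Simplex N × Lp ℝ 2 P) :=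
  {p | ∃ (a b c d : ℝ≥0) (μ ν : Fin N), a ≤ b ∧ b ≤ c ∧ c ≤ d ∧
    p.1 =ᵐ[((idxMeasure N).prod (idxMeasure N)).restrict (simplex2 N)]
      ((Set.Ioc a b ×ˢ {μ}) ×ˢ (Set.Ioc c d ×ˢ {ν})).indicator 1 ∧
    p.2 =ᵐ[P] fun ω => (W μ b ω - W μ a ω) * (W ν d ω - W ν c ω)}

lemma coeFn_restrictSimplex_sym_stepFun {a b c d : ℝ≥0} (hbc : b ≤ c) (μ ν : Fin N) :
    restrictSimplex (tensor (stepFun a b μ) (stepFun c d ν) +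
        tensor (stepFun c d ν) (stepFun a b μ))
      =ᵐ[((idxMeasure N).prod (idxMeasure N)).restrict (simplex2 N)]
      (box a b μ ×ˢ box c d ν).indicator 1 := by
  set f := stepFun a b μ with hf
  set g := stepFun c d ν with hg
  filter_upwards [coeFn_restrictSimplex (tensor f g + tensor g f),
    ae_restrict_of_ae (Lp.coeFn_add (tensor f g) (tensor g f)),
    ae_restrict_of_ae (coeFn_tensor f g), ae_restrict_of_ae (coeFn_tensor g f),
    ae_restrict_of_ae (ae_fst (m := idxMeasure N) (coeFn_stepFun a b μ)),
    ae_restrict_of_ae (ae_snd (m := idxMeasure N) (coeFn_stepFun a b μ)),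
    ae_restrict_of_ae (ae_fst (m := idxMeasure N) (coeFn_stepFun c d ν)),
    ae_restrict_of_ae (ae_snd (m := idxMeasure N) (coeFn_stepFun c d ν)),
    ae_restrict_mem measurableSet_simplex2] with p h1 h2 h3 h4 h5 h6 h7 h8 h9
  rw [h1, h2, Pi.add_apply, h3, h4, h5, h6, h7, h8]
  -- The transposed box misses the simplex: its points satisfy `s₁ > c ≥ b ≥ s₂`.
  have hz : (box c d ν).indicator (1 : Idx N → ℝ) p.1 * (box a b μ).indicator 1 p.2 = 0 := by
    by_cases h : p.1 ∈ box c d ν ∧ p.2 ∈ box a b μ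
    · exfalso
      have h9' : p.1.1 ≤ p.2.1 := h9
      exact absurd (h.1.1.1.trans_le (h9'.trans (h.2.1.2.trans hbc))) (lt_irrefl _)
    · rw [not_and_or] at h
      rcases h with h | h <;> simp [h]
  rw [hz, add_zero]
  by_cases h3 : p.1 ∈ box a b μ <;> by_cases h4 : p.2 ∈ box c d ν <;>
    simp [Set.indicator, h3, h4]

/-- The boxes are disjoint in time, so the Wick correction vanishes and the plain product of
increments remains. -/
lemma coeFn_wick_stepFun (hW : IsBrownianMotion W P) {a b c d : ℝ≥0} (hab : a ≤ b) (hbc : b ≤ c)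
    (hcd : c ≤ d) (μ ν : Fin N) :
    wick hW (stepFun a b μ) (stepFun c d ν) =ᵐ[P]
      fun ω => (W μ b ω - W μ a ω) * (W ν d ω - W ν c ω) := by
  have h0 : (inner ℝ (stepFun a b μ) (stepFun c d ν) : ℝ) = 0 := by
    rw [inner_stepFun]
    split_ifs
    · refine max_eq_right ?_
      have h : (b : ℝ) ≤ c := hbc
      linarith [min_le_left (b : ℝ) d, le_max_right (a : ℝ) c]
    · rfl
  filter_upwards [coeFn_wick hW (stepFun a b μ) (stepFun c d ν),
    MemLp.coeFn_toLp ((hW.memLp μ b).sub (hW.memLp μ a)),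
    MemLp.coeFn_toLp ((hW.memLp ν d).sub (hW.memLp ν c))] with ω h1 h2 h3
  rw [h1, h0, sub_zero, wienerIntegral_stepFun hW hab, wienerIntegral_stepFun hW hcd,
    IsBrownianMotion.incr, IsBrownianMotion.incr, h2, h3]
  rfl

lemma mem_iteratedGen_iff (hW : IsBrownianMotion W P) (p : L2Simplex N × Lp ℝ 2 P) :
    p ∈ iteratedGen W P ↔ ∃ (a b c d : ℝ≥0) (μ ν : Fin N), a ≤ b ∧ b ≤ c ∧ c ≤ d ∧
      p = (restrictSimplex (tensor (stepFun a b μ) (stepFun c d ν) +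
        tensor (stepFun c d ν) (stepFun a b μ)), wick hW (stepFun a b μ) (stepFun c d ν)) := by
  constructor
  · rintro ⟨a, b, c, d, μ, ν, hab, hbc, hcd, h1, h2⟩
    refine ⟨a, b, c, d, μ, ν, hab, hbc, hcd, Prod.ext (Lp.ext ?_) (Lp.ext ?_)⟩
    · exact h1.trans (coeFn_restrictSimplex_sym_stepFun hbc μ ν).symm
    · exact h2.trans (coeFn_wick_stepFun hW hab hbc hcd μ ν).symm
  · rintro ⟨a, b, c, d, μ, ν, hab, hbc, hcd, rfl⟩
    exact ⟨a, b, c, d, μ, ν, hab, hbc, hcd, coeFn_restrictSimplex_sym_stepFun hbc μ ν,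
      coeFn_wick_stepFun hW hab hbc hcd μ ν⟩

lemma iteratedGen_subset (hW : IsBrownianMotion W P) :
    iteratedGen W P ⊆ Submodule.span ℝ (squareGen hW) := by
  intro p hp
  obtain ⟨a, b, c, d, μ, ν, -, -, -, rfl⟩ := (mem_iteratedGen_iff hW p).1 hp
  exact sym_mem_span_squareGen hW _ _

/-- The larger graph, spanned by squares, is the one on which the isometry was verified; ordered
boxes inherit it. -/
lemma iteratedGraph_le (hW : IsBrownianMotion W P) :
    iteratedGraph W P ≤ (Submodule.span ℝ (squareGen hW)).topologicalClosure :=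
  Submodule.topologicalClosure_mono (Submodule.span_le.2 (iteratedGen_subset hW))

lemma inner_iteratedGen (hW : IsBrownianMotion W P) : ∀ p ∈ iteratedGen W P,
    ∀ q ∈ iteratedGen W P, inner ℝ p.1 q.1 = (inner ℝ p.2 q.2 : ℝ) := fun _ hp _ hq =>
  inner_eq_of_mem_closure (inner_squareGen hW)
    (Submodule.le_topologicalClosure _ (iteratedGen_subset hW hp))
    (Submodule.le_topologicalClosure _ (iteratedGen_subset hW hq))

lemma mem_iteratedGraph (hW : IsBrownianMotion W P) (K : L2Simplex N) :
    (K, iteratedIntegral W P K) ∈ iteratedGraph W P := by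
  refine Classical.epsilon_spec (exists_mem_closure (inner_iteratedGen hW) (fun f hf => ?_) K)
  refine eq_zero_of_setIntegral_box_prod f fun a b c d μ ν hab hbc hcd => ?_
  have h := hf _ ((mem_iteratedGen_iff hW _).2 ⟨a, b, c, d, μ, ν, hab, hbc, hcd, rfl⟩)
  rw [← h, L2.inner_def,
    ← integral_indicator ((measurableSet_box a b μ).prod (measurableSet_box c d ν))]
  refine integral_congr_ae ?_
  filter_upwards [coeFn_restrictSimplex_sym_stepFun (a := a) (d := d) hbc μ ν] with p hp
  rw [hp]
  by_cases h : p ∈ box a b μ ×ˢ box c d ν <;> simp [Set.indicator, h]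

/-- Uniqueness in the larger graph identifies values without approximating by ordered boxes. This is
how the integral of `f ⊗ f` is obtained. -/
lemma iteratedIntegral_eq (hW : IsBrownianMotion W P) {K : L2Simplex N} {X : Lp ℝ 2 P}
    (h : (K, X) ∈ (Submodule.span ℝ (squareGen hW)).topologicalClosure) :
    iteratedIntegral W P K = X :=
  snd_eq_of_mem_closure (inner_squareGen hW) (iteratedGraph_le hW (mem_iteratedGraph hW K)) h

/-- The iterated integral as a linear map. -/
def iteratedₗ (hW : IsBrownianMotion W P) : L2Simplex N →ₗ[ℝ] Lp ℝ 2 P where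
  toFun := iteratedIntegral W P
  map_add' K L := iteratedIntegral_eq hW (iteratedGraph_le hW
    (Submodule.add_mem _ (mem_iteratedGraph hW K) (mem_iteratedGraph hW L)))
  map_smul' c K := iteratedIntegral_eq hW (iteratedGraph_le hW
    (Submodule.smul_mem _ c (mem_iteratedGraph hW K)))

@[simp] lemma iteratedₗ_apply (hW : IsBrownianMotion W P) (K : L2Simplex N) :
    iteratedₗ hW K = iteratedIntegral W P K := rfl

lemma norm_iteratedIntegral (hW : IsBrownianMotion W P) (K : L2Simplex N) :
    ‖iteratedIntegral W P K‖ = ‖K‖ :=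
  (norm_eq_of_mem_closure (inner_iteratedGen hW) (mem_iteratedGraph hW K)).symm

lemma iteratedIntegral_tensor_self (hW : IsBrownianMotion W P) (f : L2 N) :
    iteratedIntegral W P (restrictSimplex (tensor f f)) = (1 / 2 : ℝ) • wick hW f f :=
  iteratedIntegral_eq hW (Submodule.le_topologicalClosure _ (Submodule.subset_span ⟨f, rfl⟩))

end Iterated

/-! ### The regularized determinant in finite dimension -/

section FiniteDim

variable {E ι : Type*} [NormedAddCommGroup E] [InnerProductSpace ℝ E] [FiniteDimensional ℝ E]
  [Fintype ι]

/-- The square of the Hilbert–Schmidt norm of an endomorphism. -/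
def hsSq (b : OrthonormalBasis ι ℝ E) (T : E →ₗ[ℝ] E) : ℝ :=
  ∑ i, ∑ j, (inner ℝ (b i) (T (b j)) : ℝ) ^ 2

lemma sum_norm_sq_eq_hsSq (b : OrthonormalBasis ι ℝ E) (T : E →ₗ[ℝ] E) :
    ∑ j, ‖T (b j)‖ ^ 2 = hsSq b T := by
  rw [hsSq, Finset.sum_comm]
  refine Finset.sum_congr rfl fun j _ => ?_
  rw [← b.sum_sq_norm_inner_right (T (b j))]
  simp

lemma hsSq_adjoint (b : OrthonormalBasis ι ℝ E) (T : E →ₗ[ℝ] E) :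
    hsSq b (LinearMap.adjoint T) = hsSq b T := by
  rw [hsSq, hsSq, Finset.sum_comm]
  simp only [LinearMap.adjoint_inner_right]
  refine Finset.sum_congr rfl fun i _ => Finset.sum_congr rfl fun j _ => ?_
  rw [real_inner_comm]

/-- Cauchy–Schwarz for the Hilbert–Schmidt inner product of `S*` and `T`, in the basis `b`. -/
lemma abs_trace_mul_le (b : OrthonormalBasis ι ℝ E) (S T : E →ₗ[ℝ] E) :
    |LinearMap.trace ℝ E (S * T)| ≤ √(hsSq b S) * √(hsSq b T) := by
  rw [LinearMap.trace_eq_sum_inner _ b]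
  have h1 : ∀ i, (inner ℝ (b i) ((S * T) (b i)) : ℝ) =
      inner ℝ (LinearMap.adjoint S (b i)) (T (b i)) := fun i => by
    rw [LinearMap.adjoint_inner_left]; rfl
  simp only [h1]
  calc |∑ i, (inner ℝ (LinearMap.adjoint S (b i)) (T (b i)) : ℝ)|
      ≤ ∑ i, ‖LinearMap.adjoint S (b i)‖ * ‖T (b i)‖ :=
        (Finset.abs_sum_le_sum_abs _ _).trans
          (Finset.sum_le_sum fun i _ => abs_real_inner_le_norm _ _)
    _ ≤ √(∑ i, ‖LinearMap.adjoint S (b i)‖ ^ 2) * √(∑ i, ‖T (b i)‖ ^ 2) :=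
        Real.sum_mul_le_sqrt_mul_sqrt _ _ _
    _ = _ := by rw [sum_norm_sq_eq_hsSq, sum_norm_sq_eq_hsSq, hsSq_adjoint]

/-- Carleman's inequality. -/
lemma abs_det_one_add_le (b : OrthonormalBasis ι ℝ E) (T : E →ₗ[ℝ] E) :
    |LinearMap.det (1 + T)| ≤ Real.exp (LinearMap.trace ℝ E T + hsSq b T / 2) := by
  -- Replacing `1 + T` by `(1 + T)* (1 + T)` gives nonnegative eigenvalues, determinant `det (1 +
  -- T)²` and trace `n + 2 Tr T + ‖T‖²` in Hilbert–Schmidt norm.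
  set S : E →ₗ[ℝ] E := LinearMap.adjoint (1 + T) ∘ₗ (1 + T) with hS
  have hsym : S.IsSymmetric := fun x y => by
    simp only [hS, LinearMap.comp_apply, LinearMap.adjoint_inner_left,
      LinearMap.adjoint_inner_right]
  have hinner : ∀ x, (inner ℝ x (S x) : ℝ) = ‖(1 + T) x‖ ^ 2 := fun x => by
    simp only [hS, LinearMap.comp_apply, LinearMap.adjoint_inner_right]
    exact real_inner_self_eq_norm_sq _
  have hdet : LinearMap.det S = LinearMap.det (1 + T) ^ 2 := by
    have h := LinearMap.normDet_sq (1 + T)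
    rw [LinearMap.normDet_eq_abs_det] at h
    have h' : LinearMap.det (1 + T) ^ 2 = LinearMap.det S := by simpa [hS] using h
    exact h'.symm
  have htr : LinearMap.trace ℝ E S =
      Module.finrank ℝ E + 2 * LinearMap.trace ℝ E T + hsSq b T := by
    rw [LinearMap.trace_eq_sum_inner S b, LinearMap.trace_eq_sum_inner T b,
      ← sum_norm_sq_eq_hsSq, Finset.mul_sum, Module.finrank_eq_card_basis b.toBasis]
    have h1 : ∀ i, (inner ℝ (b i) (S (b i)) : ℝ) =
        1 + 2 * inner ℝ (b i) (T (b i)) + ‖T (b i)‖ ^ 2 := fun i => by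
      rw [hinner, LinearMap.add_apply, Module.End.one_apply, norm_add_sq_real, b.norm_eq_one,
        one_pow]
    simp only [h1, Finset.sum_add_distrib]
    simp
  have hev := hsym.det_eq_prod_eigenvalues rfl
  have htv := LinearMap.IsSymmetric.trace_eq_sum_eigenvalues rfl hsym
  have hpos : ∀ i, 0 ≤ hsym.eigenvalues rfl i := fun i => by
    have h := hsym.apply_eigenvectorBasis rfl i
    have h2 := hinner (hsym.eigenvectorBasis rfl i)
    rw [h, inner_smul_right, real_inner_self_eq_norm_sq, OrthonormalBasis.norm_eq_one] at h2
    simp only [one_pow, mul_one] at h2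
    have h3 : hsym.eigenvalues rfl i = ‖(1 + T) (hsym.eigenvectorBasis rfl i)‖ ^ 2 := by
      simpa using h2
    rw [h3]
    positivity
  -- Multiply `λ ≤ exp (λ - 1)` over the eigenvalues.
  have hle : LinearMap.det S ≤ Real.exp (LinearMap.trace ℝ E S - Module.finrank ℝ E) := by
    rw [hev, htv]
    calc ∏ i, ((hsym.eigenvalues rfl i : ℝ) : ℝ)
        ≤ ∏ i, Real.exp (hsym.eigenvalues rfl i - 1) :=
          Finset.prod_le_prod (fun i _ => hpos i) fun i _ => by
            have := Real.add_one_le_exp (hsym.eigenvalues rfl i - 1)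
            simpa using this
      _ = _ := by
          rw [← Real.exp_sum]
          simp
  rw [htr, hdet] at hle
  refine abs_le_of_sq_le_sq ?_ (Real.exp_pos _).le
  rw [← Real.exp_nat_mul]
  refine hle.trans (le_of_eq ?_)
  congr 1
  push_cast
  ring

/-- Along `1 + t G` the quadratic form is a convex combination of two positive forms, so the
determinant never vanishes on `[0, 1]`; it starts at `1`. No symmetry of `G` is needed. -/
lemma det_one_add_pos (G : E →ₗ[ℝ] E)
    (hG : ∀ x : E, x ≠ 0 → 0 < (inner ℝ x ((1 + G) x) : ℝ)) : 0 < LinearMap.det (1 + G) := by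
  let b := stdOrthonormalBasis ℝ E
  have hne : ∀ t ∈ Set.Icc (0 : ℝ) 1, LinearMap.det (1 + t • G) ≠ 0 := by
    intro t ht h0
    obtain ⟨x, hx, hx0⟩ := (Submodule.ne_bot_iff _).1 (LinearMap.bot_lt_ker_of_det_eq_zero h0).ne'
    have h1 : (inner ℝ x ((1 + t • G) x) : ℝ) =
        (1 - t) * ‖x‖ ^ 2 + t * inner ℝ x ((1 + G) x) := by
      simp only [LinearMap.add_apply, Module.End.one_apply, LinearMap.smul_apply, inner_add_right,
        inner_smul_right, real_inner_self_eq_norm_sq]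
      ring
    rw [LinearMap.mem_ker.1 hx, inner_zero_right] at h1
    have h2 := hG x hx0
    have h3 : 0 < ‖x‖ ^ 2 := by positivity
    rcases eq_or_lt_of_le ht.2 with h | h
    · subst h; linarith
    · have : 0 < (1 - t) * ‖x‖ ^ 2 := mul_pos (by linarith) h3
      have : 0 ≤ t * (inner ℝ x ((1 + G) x) : ℝ) := mul_nonneg ht.1 h2.le
      linarith
  have hc : Continuous fun t : ℝ => LinearMap.det (1 + t • G) := by
    have : (fun t : ℝ => LinearMap.det (1 + t • G)) = fun t =>
        (LinearMap.toMatrix b.toBasis b.toBasis 1 +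
          t • LinearMap.toMatrix b.toBasis b.toBasis G).det := by
      funext t
      rw [← LinearMap.det_toMatrix b.toBasis, map_add, map_smul]
    rw [this]
    exact Continuous.matrix_det (by fun_prop)
  by_contra hle
  rw [not_lt] at hle
  have hmem : (0 : ℝ) ∈ Set.Icc (LinearMap.det (1 + (1 : ℝ) • G))
      (LinearMap.det (1 + (0 : ℝ) • G)) := by simp [hle]
  obtain ⟨t, ht, h0⟩ := intermediate_value_Icc' zero_le_one hc.continuousOn hmem
  exact hne t ht h0

/-- Comparison of regularized determinants. -/
lemma det_mul_exp_neg_trace_le (b : OrthonormalBasis ι ℝ E) (F G : E →ₗ[ℝ] E) {ε : ℝ} (hε : 0 < ε)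
    (hG : ∀ x : E, ε * ‖x‖ ^ 2 ≤ inner ℝ x ((1 + G) x)) :
    LinearMap.det (1 + F) * Real.exp (-LinearMap.trace ℝ E F) ≤
      LinearMap.det (1 + G) * Real.exp (-LinearMap.trace ℝ E G) *
        Real.exp ((√(hsSq b (F - G)) / ε) ^ 2 / 2 + √(hsSq b G) * (√(hsSq b (F - G)) / ε)) := by
  have hpos : 0 < LinearMap.det (1 + G) := det_one_add_pos G fun x hx =>
    lt_of_lt_of_le (by positivity) (hG x)
  have hlow : ∀ x, ε * ‖x‖ ≤ ‖(1 + G) x‖ := by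
    intro x
    rcases eq_or_ne x 0 with rfl | hx
    · simp
    · have h1 := (hG x).trans (real_inner_le_norm _ _)
      have h2 : 0 < ‖x‖ := norm_pos_iff.2 hx
      nlinarith
  set R : E →ₗ[ℝ] E := Ring.inverse (1 + G) with hR
  have hunit : IsUnit (1 + G) := by
    rw [LinearMap.isUnit_iff_isUnit_det]
    exact hpos.ne'.isUnit
  have hGR : (1 + G) * R = 1 := Ring.mul_inverse_cancel _ hunit
  -- `D` is the relative perturbation: `1 + F = (1 + G) (1 + D)`, hence `F = G + D + G D`.
  -- Carleman's inequality handles `det (1 + D) exp (-Tr D)`, and Cauchy–Schwarz the remaining `Tr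
  -- (G D)`.
  set D : E →ₗ[ℝ] E := R * (F - G) with hD
  have hGD : (1 + G) * D = F - G := by rw [hD, ← mul_assoc, hGR, one_mul]
  have hprod : (1 + G) * (1 + D) = 1 + F := by rw [mul_add, mul_one, hGD]; abel
  have hdet : LinearMap.det (1 + F) = LinearMap.det (1 + G) * LinearMap.det (1 + D) := by
    rw [← hprod, map_mul]
  have hF : F = G + D + G * D := by
    have : F = G + (1 + G) * D := by rw [hGD]; abel
    rw [this, add_mul, one_mul, add_assoc]
  have htr : LinearMap.trace ℝ E F = LinearMap.trace ℝ E G + LinearMap.trace ℝ E D +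
      LinearMap.trace ℝ E (G * D) := by
    conv_lhs => rw [hF]
    rw [map_add, map_add]
  -- Coercivity bounds the inverse of `1 + G` by `1 / ε`, applied columnwise to `F - G`.
  have hDle : √(hsSq b D) ≤ √(hsSq b (F - G)) / ε := by
    rw [le_div_iff₀ hε, mul_comm]
    have h1 : ε ^ 2 * hsSq b D ≤ hsSq b (F - G) := by
      rw [← sum_norm_sq_eq_hsSq, ← sum_norm_sq_eq_hsSq, Finset.mul_sum]
      refine Finset.sum_le_sum fun j _ => ?_
      rw [← mul_pow, ← hGD]
      exact pow_le_pow_left₀ (by positivity) (hlow _) 2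
    calc ε * √(hsSq b D) = √(ε ^ 2 * hsSq b D) := by
          rw [Real.sqrt_mul (sq_nonneg ε), Real.sqrt_sq hε.le]
      _ ≤ _ := Real.sqrt_le_sqrt h1
  have hDnn : 0 ≤ hsSq b D := Finset.sum_nonneg fun i _ => Finset.sum_nonneg fun j _ => sq_nonneg _
  have hcar := (le_abs_self _).trans (abs_det_one_add_le b D)
  have htrGD := (neg_le_abs _).trans (abs_trace_mul_le b G D)
  calc LinearMap.det (1 + F) * Real.exp (-LinearMap.trace ℝ E F)
      ≤ LinearMap.det (1 + G) * Real.exp (LinearMap.trace ℝ E D + hsSq b D / 2) *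
          Real.exp (-LinearMap.trace ℝ E F) := by
        rw [hdet]
        gcongr
    _ = LinearMap.det (1 + G) * Real.exp (-LinearMap.trace ℝ E G) *
          Real.exp (hsSq b D / 2 + -LinearMap.trace ℝ E (G * D)) := by
        rw [mul_assoc, mul_assoc, ← Real.exp_add, ← Real.exp_add, htr]
        congr 2
        ring
    _ ≤ _ := by
        have h2 : hsSq b D ≤ (√(hsSq b (F - G)) / ε) ^ 2 := by
          rw [← Real.sq_sqrt hDnn]
          exact pow_le_pow_left₀ (Real.sqrt_nonneg _) hDle 2
        gcongr
        exact htrGD.trans (by gcongr)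

end FiniteDim

/-! ### Finite rank operators -/

section FiniteRank

variable {H : Type*} [AddCommGroup H] [Module ℝ H]

/-- Determinant and trace can be computed on any finite-dimensional subspace containing the
range. -/
lemma finiteRankDet2_eq (T : H →ₗ[ℝ] H) (V : Submodule ℝ H) [FiniteDimensional ℝ V]
    (hV : ∀ x, T x ∈ V) :
    finiteRankDet2 T = LinearMap.det (1 + T.restrict fun x (_ : x ∈ V) => hV x) *
      Real.exp (-LinearMap.trace ℝ V (T.restrict fun x (_ : x ∈ V) => hV x)) := by
  set TV : V →ₗ[ℝ] V := T.restrict fun x (_ : x ∈ V) => hV x with hTV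
  set TR : LinearMap.range T →ₗ[ℝ] LinearMap.range T :=
    T.restrict (fun x _ => LinearMap.mem_range_self T x) with hTR
  have hRV : LinearMap.range T ≤ V := by rintro _ ⟨x, rfl⟩; exact hV x
  set U : Submodule ℝ V := (LinearMap.range T).comap V.subtype with hU
  have hTU : ∀ x, TV x ∈ U := fun x => LinearMap.mem_range_self T x.1
  let e : U ≃ₗ[ℝ] LinearMap.range T := Submodule.comapSubtypeEquivOfLe hRV
  set TU : U →ₗ[ℝ] U := TV.restrict fun x (_ : x ∈ U) => hTU x with hTUdef
  have hconj : e.conj TU = TR := by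
    ext x
    rw [LinearEquiv.conj_apply_apply]
    rfl
  have h1 : LinearMap.trace ℝ V TV = LinearMap.trace ℝ _ TR := by
    rw [← LinearMap.trace_restrict_eq_of_forall_mem U TV hTU, ← hconj, LinearMap.trace_conj']
  have hle : U ≤ U.comap (1 + TV) := fun x hx => U.add_mem hx (hTU x)
  have h2 : LinearMap.det (1 + TV) = LinearMap.det (1 + TR) := by
    rw [LinearMap.det_eq_det_mul_det U (1 + TV) hle]
    -- `T` maps `V` into `U`, so `1 + T` is block triangular with the identity on `V / U`; only the
    -- block on `U` contributes.
    have hq : U.mapQ U (1 + TV) hle = LinearMap.id := by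
      refine LinearMap.ext fun y => ?_
      obtain ⟨x, rfl⟩ := U.mkQ_surjective y
      rw [Submodule.mkQ_apply, Submodule.mapQ_apply, LinearMap.id_apply, Submodule.Quotient.eq]
      simpa using hTU x
    have hr : (1 + TV).restrict hle = 1 + TU := by
      ext x
      rfl
    have hc : 1 + TR = e.conj (1 + TU) := by
      rw [map_add, hconj]
      congr 1
    rw [hq, LinearMap.det_id, mul_one, hr, hc]
    exact (LinearMap.det_conj (1 + TU) e).symm
  rw [finiteRankDet2, h1, h2]

end FiniteRank

/-! ### The Carleman–Fredholm determinant -/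

section Det2

variable {α : Type*} [MeasurableSpace α] {m : Measure α} [SigmaFinite m]

lemma orthonormal_tensor {ι κ : Type*} {v : ι → Lp ℝ 2 m} {w : κ → Lp ℝ 2 m}
    (hv : Orthonormal ℝ v) (hw : Orthonormal ℝ w) :
    Orthonormal ℝ fun p : ι × κ => tensor (v p.1) (w p.2) := by
  classical
  rw [orthonormal_iff_ite] at hv hw ⊢
  rintro ⟨i, j⟩ ⟨i', j'⟩
  rw [inner_tensor_tensor, hv, hw]
  by_cases h : i = i' <;> by_cases h' : j = j' <;> simp [h, h']

/-- Bessel's inequality in the kernel space for the orthonormal family `vᵢ ⊗ vⱼ`. -/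
lemma sum_inner_kernelOp_sq_le {ι : Type*} [Fintype ι] {v : ι → Lp ℝ 2 m} (hv : Orthonormal ℝ v)
    (K : Lp ℝ 2 (m.prod m)) :
    ∑ i, ∑ j, (inner ℝ (v i) (kernelOp K (v j)) : ℝ) ^ 2 ≤ ‖K‖ ^ 2 := by
  rw [← Fintype.sum_prod_type']
  have h := (orthonormal_tensor hv hv).sum_inner_products_le K (s := Finset.univ)
  simpa only [inner_kernelOp, Real.norm_eq_abs, sq_abs] using h

/-- Restriction of a finite rank integral operator to a subspace containing its range. -/
lemma sqrt_hsSq_restrict_le {ι : Type*} [Fintype ι] (V : Submodule ℝ (Lp ℝ 2 m))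
    [FiniteDimensional ℝ V] (b : OrthonormalBasis ι ℝ V) (K : Lp ℝ 2 (m.prod m)) (T : V →ₗ[ℝ] V)
    (hT : ∀ x, (T x : Lp ℝ 2 m) = kernelOp K x) : √(hsSq b T) ≤ ‖K‖ := by
  refine Real.sqrt_le_iff.2 ⟨norm_nonneg _, ?_⟩
  have h := sum_inner_kernelOp_sq_le
    (b.orthonormal.comp_linearIsometry V.subtypeₗᵢ) K
  refine le_trans (le_of_eq ?_) h
  refine Finset.sum_congr rfl fun i _ => Finset.sum_congr rfl fun j _ => ?_
  simp only [Function.comp_apply, Submodule.coe_subtypeₗᵢ, Submodule.subtype_apply, ← hT,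
    Submodule.coe_inner]

/-- `det (1 + K) exp (-Tr K)` for a kernel of finite rank. -/
abbrev rankDet2 (K : Lp ℝ 2 (m.prod m)) : ℝ :=
  finiteRankDet2 (kernelOp K : Lp ℝ 2 m →ₗ[ℝ] Lp ℝ 2 m)

lemma rankDet2_pos {L : Lp ℝ 2 (m.prod m)} (hL : L ∈ finiteRankKernels m) {ε : ℝ} (hε : 0 < ε)
    (hpos : ∀ x, ε * ‖x‖ ^ 2 ≤ inner ℝ x ((1 + kernelOp L) x)) : 0 < rankDet2 L := by
  have : FiniteDimensional ℝ (LinearMap.range (kernelOp L : Lp ℝ 2 m →ₗ[ℝ] Lp ℝ 2 m)) := hL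
  rw [rankDet2, finiteRankDet2_eq (kernelOp L : Lp ℝ 2 m →ₗ[ℝ] Lp ℝ 2 m)
    (LinearMap.range (kernelOp L : Lp ℝ 2 m →ₗ[ℝ] Lp ℝ 2 m)) fun x => ⟨x, rfl⟩]
  refine mul_pos (det_one_add_pos _ fun x hx => ?_) (Real.exp_pos _)
  have h0 : 0 < ‖(x : Lp ℝ 2 m)‖ := norm_pos_iff.2 fun h => hx (Subtype.ext h)
  exact lt_of_lt_of_le (by positivity) (hpos x)

/-- Both determinants are computed on the sum of the two ranges, where the finite-dimensional
comparison applies. Coercivity is asked of `L` only; taking `K = 0` later gives a lower bound for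
the determinant of `L`. -/
lemma rankDet2_le {K L : Lp ℝ 2 (m.prod m)} (hK : K ∈ finiteRankKernels m)
    (hL : L ∈ finiteRankKernels m) {ε : ℝ} (hε : 0 < ε)
    (hpos : ∀ x, ε * ‖x‖ ^ 2 ≤ inner ℝ x ((1 + kernelOp L) x)) :
    rankDet2 K ≤ rankDet2 L *
      Real.exp ((‖K - L‖ / ε) ^ 2 / 2 + ‖L‖ * (‖K - L‖ / ε)) := by
  have : FiniteDimensional ℝ (LinearMap.range (kernelOp K : Lp ℝ 2 m →ₗ[ℝ] Lp ℝ 2 m)) := hK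
  have : FiniteDimensional ℝ (LinearMap.range (kernelOp L : Lp ℝ 2 m →ₗ[ℝ] Lp ℝ 2 m)) := hL
  set V := LinearMap.range (kernelOp K : Lp ℝ 2 m →ₗ[ℝ] Lp ℝ 2 m) ⊔
    LinearMap.range (kernelOp L : Lp ℝ 2 m →ₗ[ℝ] Lp ℝ 2 m) with hV
  have hVK : ∀ x, kernelOp K x ∈ V := fun x => Submodule.mem_sup_left ⟨x, rfl⟩
  have hVL : ∀ x, kernelOp L x ∈ V := fun x => Submodule.mem_sup_right ⟨x, rfl⟩
  let b := stdOrthonormalBasis ℝ V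
  rw [rankDet2, rankDet2, finiteRankDet2_eq (kernelOp K : Lp ℝ 2 m →ₗ[ℝ] Lp ℝ 2 m) V hVK,
    finiteRankDet2_eq (kernelOp L : Lp ℝ 2 m →ₗ[ℝ] Lp ℝ 2 m) V hVL]
  set F : V →ₗ[ℝ] V := (kernelOp K : Lp ℝ 2 m →ₗ[ℝ] Lp ℝ 2 m).restrict fun x (_ : x ∈ V) => hVK x
    with hF
  set G : V →ₗ[ℝ] V := (kernelOp L : Lp ℝ 2 m →ₗ[ℝ] Lp ℝ 2 m).restrict fun x (_ : x ∈ V) => hVL x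
    with hG
  have hGpos : ∀ x : V, ε * ‖x‖ ^ 2 ≤ inner ℝ x ((1 + G) x) := fun x => hpos x
  refine (det_mul_exp_neg_trace_le b F G hε hGpos).trans ?_
  have h1 : √(hsSq b (F - G)) ≤ ‖K - L‖ := sqrt_hsSq_restrict_le V b (K - L) (F - G) fun x => by
    rw [kernelOp_sub]; rfl
  have h2 : √(hsSq b G) ≤ ‖L‖ := sqrt_hsSq_restrict_le V b L G fun x => rfl
  have h3 : 0 < LinearMap.det (1 + G) := det_one_add_pos G fun x hx => by
    have h0 : 0 < ‖x‖ := norm_pos_iff.2 hx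
    exact lt_of_lt_of_le (by positivity) (hGpos x)
  gcongr

lemma finiteRankKernels_of_forall_mem {K : Lp ℝ 2 (m.prod m)} (V : Submodule ℝ (Lp ℝ 2 m))
    [FiniteDimensional ℝ V] (h : ∀ x, kernelOp K x ∈ V) : K ∈ finiteRankKernels m := by
  refine Submodule.finiteDimensional_of_le (S₂ := V) ?_
  rintro _ ⟨x, rfl⟩
  exact h x

/-- A kernel in the span of the tensor products lives on a finite-dimensional subspace. -/
lemma exists_subspace_of_mem_span {K : Lp ℝ 2 (m.prod m)}
    (hK : K ∈ Submodule.span ℝ (Set.range fun p : Lp ℝ 2 m × Lp ℝ 2 m => tensor p.1 p.2)) :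
    ∃ V : Submodule ℝ (Lp ℝ 2 m), FiniteDimensional ℝ V ∧
      K ∈ Submodule.span ℝ (Set.image2 tensor (V : Set (Lp ℝ 2 m)) V) := by
  induction hK using Submodule.span_induction with
  | mem x hx =>
    obtain ⟨⟨f, g⟩, rfl⟩ := hx
    refine ⟨Submodule.span ℝ {f, g}, FiniteDimensional.span_of_finite ℝ (Set.toFinite _),
      Submodule.subset_span ⟨f, ?_, g, ?_, rfl⟩⟩
    · exact Submodule.subset_span (by simp)
    · exact Submodule.subset_span (by simp)
  | zero => exact ⟨⊥, inferInstance, Submodule.zero_mem _⟩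
  | add x y _ _ hx hy =>
    obtain ⟨V, _, hV⟩ := hx
    obtain ⟨U, _, hU⟩ := hy
    refine ⟨V ⊔ U, inferInstance, Submodule.add_mem _
      (Submodule.span_mono (Set.image2_subset ?_ ?_) hV)
      (Submodule.span_mono (Set.image2_subset ?_ ?_) hU)⟩
    · exact (le_sup_left : V ≤ V ⊔ U)
    · exact (le_sup_left : V ≤ V ⊔ U)
    · exact (le_sup_right : U ≤ V ⊔ U)
    · exact (le_sup_right : U ≤ V ⊔ U)
  | smul c x _ hx =>
    obtain ⟨V, hf, hV⟩ := hx
    exact ⟨V, hf, Submodule.smul_mem _ c hV⟩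

lemma kernelOp_mem_of_mem_span {V : Submodule ℝ (Lp ℝ 2 m)} {K : Lp ℝ 2 (m.prod m)}
    (hK : K ∈ Submodule.span ℝ (Set.image2 tensor (V : Set (Lp ℝ 2 m)) V)) (x : Lp ℝ 2 m) :
    kernelOp K x ∈ V := by
  induction hK using Submodule.span_induction with
  | mem K hK =>
    obtain ⟨f, hf, g, hg, rfl⟩ := hK
    rw [kernelOp_tensor]
    exact V.smul_mem _ hf
  | zero =>
    have : kernelOp (0 : Lp ℝ 2 (m.prod m)) = 0 := by simpa using kernelOp_smul 0 0 (m := m)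
    rw [this]
    exact V.zero_mem
  | add K L _ _ hK hL => rw [kernelOp_add]; exact V.add_mem hK hL
  | smul c K _ hK => rw [kernelOp_smul]; exact V.smul_mem c hK

lemma mem_closure_finiteRankKernels (C : Lp ℝ 2 (m.prod m)) : C ∈ closure (finiteRankKernels m) := by
  refine closure_mono (fun K hK => ?_) (mem_closure_span_tensor C)
  obtain ⟨V, hf, hV⟩ := exists_subspace_of_mem_span hK
  exact finiteRankKernels_of_forall_mem V (kernelOp_mem_of_mem_span hV)

/-- The operator norm is at most the Hilbert–Schmidt norm, so the quadratic form changes by at most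
`δ ‖x‖²`. -/
lemma coercive_of_norm_sub_le {C K : Lp ℝ 2 (m.prod m)} {ε δ : ℝ}
    (hpos : ∀ x, ε * ‖x‖ ^ 2 ≤ inner ℝ x ((1 + kernelOp C) x)) (h : ‖K - C‖ ≤ δ) (x : Lp ℝ 2 m) :
    (ε - δ) * ‖x‖ ^ 2 ≤ inner ℝ x ((1 + kernelOp K) x) := by
  have h1 : kernelOp K = kernelOp C + kernelOp (K - C) := by rw [kernelOp_sub]; abel
  have h2 : |(inner ℝ x (kernelOp (K - C) x) : ℝ)| ≤ δ * ‖x‖ ^ 2 := by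
    calc |(inner ℝ x (kernelOp (K - C) x) : ℝ)| ≤ ‖x‖ * ‖kernelOp (K - C) x‖ :=
          abs_real_inner_le_norm _ _
      _ ≤ ‖x‖ * (δ * ‖x‖) := by
          gcongr
          exact (kernelOp (K - C)).le_of_opNorm_le ((norm_kernelOp_le _).trans h) x
      _ = _ := by ring
  have h3 := hpos x
  rw [h1, ← add_assoc, add_apply, inner_add_right]
  linarith [neg_le_of_abs_le h2]

/-- Existence and positivity of the limit defining `det₂ (1 + C)` when `1 + C` is coercive. -/
lemma tendsto_rankDet2 (C : Lp ℝ 2 (m.prod m)) {ε : ℝ} (hε : 0 < ε)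
    (hpos : ∀ x, ε * ‖x‖ ^ 2 ≤ inner ℝ x ((1 + kernelOp C) x)) :
    0 < det2 C ∧ Filter.Tendsto (fun K => rankDet2 K) (nhdsWithin C (finiteRankKernels m))
      (nhds (det2 C)) := by
  -- Radius `ε / 2` preserves coercivity with half the constant; radius `1 / 2` keeps distances
  -- inside the ball at most `1`, so the quadratic error term is dominated by a linear one.
  set ρ : ℝ := min (ε / 2) (1 / 2) with hρ
  have hρ0 : 0 < ρ := lt_min (by linarith) (by norm_num)
  set S := finiteRankKernels m ∩ Metric.ball C ρ with hS
  have hco : ∀ K ∈ S, ∀ x, ε / 2 * ‖x‖ ^ 2 ≤ inner ℝ x ((1 + kernelOp K) x) := by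
    intro K hK x
    have h1 : ‖K - C‖ ≤ ε / 2 := by
      rw [← dist_eq_norm]; exact (Metric.mem_ball.1 hK.2).le.trans (min_le_left _ _)
    have := coercive_of_norm_sub_le hpos h1 x
    rwa [sub_half] at this
  set M : ℝ := (2 / ε) ^ 2 / 2 + (‖C‖ + 1) * (2 / ε) with hM
  have hM0 : 0 ≤ M := by positivity
  have hlog : ∀ K ∈ S, ∀ L ∈ S,
      Real.log (rankDet2 K) - Real.log (rankDet2 L) ≤ M * ‖K - L‖ := by
    intro K hK L hL
    have hK0 := rankDet2_pos hK.1 (half_pos hε) (hco K hK)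
    have hL0 := rankDet2_pos hL.1 (half_pos hε) (hco L hL)
    have h := Real.log_le_log hK0 (rankDet2_le hK.1 hL.1 (half_pos hε) (hco L hL))
    rw [Real.log_mul hL0.ne' (Real.exp_pos _).ne', Real.log_exp] at h
    have hd : ‖K - L‖ ≤ 1 := by
      rw [← dist_eq_norm]
      have h1 := Metric.mem_ball.1 hK.2
      have h2 := Metric.mem_ball'.1 hL.2
      have h3 := dist_triangle K C L
      have h4 : ρ ≤ 1 / 2 := min_le_right _ _
      linarith
    have hLn : ‖L‖ ≤ ‖C‖ + 1 := by
      have h1 := Metric.mem_ball.1 hL.2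
      rw [dist_eq_norm] at h1
      have h3 := norm_le_norm_add_norm_sub' L C
      have h4 : ρ ≤ 1 / 2 := min_le_right _ _
      linarith
    have h5 : ‖K - L‖ / (ε / 2) = 2 / ε * ‖K - L‖ := by field_simp
    rw [h5] at h
    have h6 : ‖K - L‖ ^ 2 ≤ ‖K - L‖ := by
      have := norm_nonneg (K - L)
      nlinarith
    have h7 : (2 / ε * ‖K - L‖) ^ 2 / 2 ≤ (2 / ε) ^ 2 / 2 * ‖K - L‖ := by
      rw [mul_pow]
      have : 0 ≤ (2 / ε) ^ 2 := sq_nonneg _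
      nlinarith
    have h8 : ‖L‖ * (2 / ε * ‖K - L‖) ≤ (‖C‖ + 1) * (2 / ε) * ‖K - L‖ := by
      rw [← mul_assoc]
      gcongr
    rw [hM, add_mul]
    linarith
  have hlip : LipschitzOnWith M.toNNReal (fun K => Real.log (rankDet2 K)) S := by
    refine LipschitzOnWith.of_dist_le_mul fun K hK L hL => ?_
    rw [Real.coe_toNNReal _ hM0, Real.dist_eq, dist_eq_norm, abs_le]
    refine ⟨?_, hlog K hK L hL⟩
    have := hlog L hL K hK
    rw [norm_sub_rev] at this
    linarith
  -- `C` itself need not have finite rank. A Lipschitz extension of the logarithm to the whole space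
  -- supplies the limit at `C`, and its exponential is positive.
  obtain ⟨g, hg, hgS⟩ := hlip.extend_real
  have ht : Filter.Tendsto (fun K => rankDet2 K) (nhdsWithin C (finiteRankKernels m))
      (nhds (Real.exp (g C))) := by
    have h1 : Filter.Tendsto (fun K => Real.exp (g K)) (nhdsWithin C (finiteRankKernels m))
        (nhds (Real.exp (g C))) :=
      ((Real.continuous_exp.comp hg.continuous).tendsto C).mono_left nhdsWithin_le_nhds
    refine h1.congr' ?_
    filter_upwards [self_mem_nhdsWithin, mem_nhdsWithin_of_mem_nhds (Metric.ball_mem_nhds C hρ0)]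
      with K h2 h3
    rw [← hgS ⟨h2, h3⟩, Real.exp_log (rankDet2_pos h2 (half_pos hε) (hco K ⟨h2, h3⟩))]
  have he : det2 C = Real.exp (g C) := extendFrom_eq (mem_closure_finiteRankKernels C) ht
  rw [he]
  exact ⟨Real.exp_pos _, ht⟩

end Det2

/-! ### Gaussian integrals -/

/-- Complete the square: the exponent is centred at `-b / (1 + l)` with precision `1 + l`, and the
`-1` contributes `exp (l / 2)`. -/
lemma integral_exp_quadratic_gaussianReal {l : ℝ} (hl : 0 < 1 + l) (b : ℝ) :
    ∫ x, Real.exp (-(b * x + l / 2 * (x ^ 2 - 1))) ∂gaussianReal 0 1 =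
      ((1 + l) * Real.exp (-l)) ^ (-(1 / 2) : ℝ) * Real.exp (1 / 2 * (b ^ 2 / (1 + l))) := by
  have hfun : ∀ x : ℝ, gaussianPDFReal 0 1 x • Real.exp (-(b * x + l / 2 * (x ^ 2 - 1))) =
      ((√(2 * Real.pi))⁻¹ * Real.exp (l / 2) * Real.exp (1 / 2 * (b ^ 2 / (1 + l)))) *
        Real.exp (-((1 + l) / 2) * (x + b / (1 + l)) ^ 2) := by
    intro x
    rw [gaussianPDFReal, smul_eq_mul, NNReal.coe_one, mul_one, mul_assoc, mul_assoc, mul_assoc,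
      ← Real.exp_add, ← Real.exp_add, ← Real.exp_add]
    congr 2
    field_simp
    ring
  rw [integral_gaussianReal_eq_integral_smul one_ne_zero]
  simp only [hfun]
  rw [integral_const_mul,
    integral_add_right_eq_self (fun x => Real.exp (-((1 + l) / 2) * x ^ 2)) (b / (1 + l)),
    integral_gaussian]
  have h1 : √(Real.pi / ((1 + l) / 2)) = √(2 * Real.pi) * (1 + l) ^ (-(1 / 2) : ℝ) := by
    rw [show Real.pi / ((1 + l) / 2) = 2 * Real.pi * (1 + l)⁻¹ by field_simp,
      Real.sqrt_mul (by positivity), Real.sqrt_inv, Real.sqrt_eq_rpow (1 + l),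
      Real.rpow_neg hl.le]
  rw [h1, Real.mul_rpow hl.le (Real.exp_pos _).le, ← Real.exp_mul]
  have h2 : √(2 * Real.pi) ≠ 0 := by positivity
  rw [show -l * -(1 / 2) = l / 2 by ring]
  field_simp

/-! ### Independent normal coordinates and diagonal kernels -/

section Diagonal

variable {Ω : Type*} [MeasurableSpace Ω] {P : Measure Ω} [IsProbabilityMeasure P] {N : ℕ}
  {W : Fin N → ℝ≥0 → Ω → ℝ} {ι : Type*} [Fintype ι]

lemma wienerIntegral_sum (hW : IsBrownianMotion W P) (b : ι → ℝ) (e : ι → L2 N) :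
    wienerIntegral W P (∑ i, b i • e i) =ᵐ[P] fun ω => ∑ i, b i * wienerIntegral W P (e i) ω := by
  have h : wienerIntegral W P (∑ i, b i • e i) = ∑ i, b i • wienerIntegral W P (e i) := by
    simp only [← wienerₗ_apply hW, map_sum, map_smul]
  rw [h]
  filter_upwards [Lp.coeFn_fun_finsetSum Finset.univ fun i => b i • wienerIntegral W P (e i),
    ae_all_iff.2 fun i => Lp.coeFn_smul (b i) (wienerIntegral W P (e i))] with ω h1 h2
  rw [h1]
  exact Finset.sum_congr rfl fun i _ => by rw [h2 i, Pi.smul_apply, smul_eq_mul]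

lemma measurable_Lp (X : Lp ℝ 2 P) : Measurable X := (Lp.stronglyMeasurable X).measurable

/-- Each linear functional of the vector is almost surely the Wiener integral of the corresponding
combination of the `e i`, whose law is known. -/
lemma hasGaussianLaw_wienerIntegral (hW : IsBrownianMotion W P) (e : ι → L2 N) :
    HasGaussianLaw (fun ω i => wienerIntegral W P (e i) ω) P where
  isGaussian_map := by
    classical
    refine isGaussian_of_map_eq_gaussianReal fun L => ⟨0,
      (‖∑ i, L (Pi.single i 1) • e i‖ ^ 2).toNNReal, ?_⟩
    rw [Measure.map_map (by fun_prop) (measurable_pi_lambda _ fun i => measurable_Lp _),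
      ← map_wienerIntegral hW]
    refine Measure.map_congr (Filter.EventuallyEq.symm ?_)
    refine (wienerIntegral_sum hW _ e).trans (Filter.Eventually.of_forall fun ω => ?_)
    simp only [Function.comp_apply]
    conv_rhs => rw [pi_eq_sum_univ' fun i => wienerIntegral W P (e i) ω, map_sum]
    refine Finset.sum_congr rfl fun i _ => ?_
    rw [map_smul, smul_eq_mul, mul_comm]

/-- The Wiener integrals of an orthonormal family are independent standard normal variables. -/
lemma map_wienerIntegral_orthonormal (hW : IsBrownianMotion W P) {e : ι → L2 N}
    (he : Orthonormal ℝ e) :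
    P.map (fun ω i => wienerIntegral W P (e i) ω) = Measure.pi fun _ => gaussianReal 0 1 := by
  have h0 : ∀ f : L2 N, P[wienerIntegral W P f] = 0 := fun f => by
    have h := integral_map (μ := P) (measurable_Lp (wienerIntegral W P f)).aemeasurable
      (f := id) aestronglyMeasurable_id
    rw [map_wienerIntegral hW f] at h
    rw [← integral_id_gaussianReal (μ := 0) (v := (‖f‖ ^ 2).toNNReal)]
    exact h.symm
  have hind : ProbabilityTheory.iIndepFun (fun i => wienerIntegral W P (e i) : ι → Ω → ℝ) P := by
    refine (hasGaussianLaw_wienerIntegral hW e).iIndepFun_of_covariance_eq_zero fun i j hij => ?_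
    rw [covariance_eq_sub (Lp.memLp _) (Lp.memLp _), h0, zero_mul, sub_zero, ← he.2 hij,
      ← inner_wienerIntegral hW, L2.inner_def]
    refine integral_congr_ae (Filter.Eventually.of_forall fun ω => ?_)
    simp [mul_comm]
  rw [(iIndepFun_iff_map_fun_eq_pi_map fun i => (measurable_Lp _).aemeasurable).1 hind]
  congr 1
  funext i
  rw [map_wienerIntegral hW, he.1 i]
  simp

lemma iteratedIntegral_sum (hW : IsBrownianMotion W P) (l : ι → ℝ) {e : ι → L2 N}
    (he : Orthonormal ℝ e) :
    iteratedIntegral W P (restrictSimplex (∑ i, l i • tensor (e i) (e i))) =ᵐ[P]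
      fun ω => ∑ i, l i / 2 * (wienerIntegral W P (e i) ω ^ 2 - 1) := by
  have h : iteratedIntegral W P (restrictSimplex (∑ i, l i • tensor (e i) (e i))) =
      ∑ i, (l i / 2) • wick hW (e i) (e i) := by
    rw [← iteratedₗ_apply hW, ← restrictₗ_apply, map_sum, map_sum]
    refine Finset.sum_congr rfl fun i _ => ?_
    rw [map_smul, map_smul, restrictₗ_apply, iteratedₗ_apply, iteratedIntegral_tensor_self hW,
      smul_smul]
    congr 1
    ring
  rw [h]
  filter_upwards [Lp.coeFn_fun_finsetSum Finset.univ fun i => (l i / 2) • wick hW (e i) (e i),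
    ae_all_iff.2 fun i => Lp.coeFn_smul (l i / 2) (wick hW (e i) (e i)),
    ae_all_iff.2 fun i => coeFn_wick hW (e i) (e i)] with ω h1 h2 h3
  rw [h1]
  refine Finset.sum_congr rfl fun i _ => ?_
  rw [h2 i, Pi.smul_apply, smul_eq_mul, h3 i, real_inner_self_eq_norm_sq, he.1 i]
  ring

/-- The exponential is a product of functions of independent standard normals, so its expectation is
a product of one-dimensional integrals. -/
lemma integral_exp_neg_quadVar_diagonal (hW : IsBrownianMotion W P) (A : ℝ) {e : ι → L2 N}
    (he : Orthonormal ℝ e) (b l : ι → ℝ) (hl : ∀ i, 0 < 1 + l i) :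
    ∫ ω, Real.exp (-quadVar W P A (∑ i, b i • e i) (∑ i, l i • tensor (e i) (e i)) ω) ∂P =
      (∏ i, (1 + l i) * Real.exp (-l i)) ^ (-(1 / 2) : ℝ) *
        Real.exp (-A + 1 / 2 * ∑ i, b i ^ 2 / (1 + l i)) := by
  have h1 : ∀ᵐ ω ∂P,
      Real.exp (-quadVar W P A (∑ i, b i • e i) (∑ i, l i • tensor (e i) (e i)) ω) =
      Real.exp (-A) * ∏ i, Real.exp (-(b i * wienerIntegral W P (e i) ω +
        l i / 2 * (wienerIntegral W P (e i) ω ^ 2 - 1))) := by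
    filter_upwards [wienerIntegral_sum hW b e, iteratedIntegral_sum hW l he] with ω h1 h2
    rw [quadVar, h1, h2, ← Real.exp_sum, ← Real.exp_add, Finset.sum_neg_distrib,
      Finset.sum_add_distrib]
    congr 1
    ring
  rw [integral_congr_ae h1, integral_const_mul]
  have h2 := integral_map (μ := P) (φ := fun ω i => wienerIntegral W P (e i) ω)
    (measurable_pi_lambda _ fun i => measurable_Lp (wienerIntegral W P (e i))).aemeasurable
    (f := fun x : ι → ℝ => ∏ i, Real.exp (-(b i * x i + l i / 2 * (x i ^ 2 - 1))))
    (Continuous.aestronglyMeasurable (by fun_prop))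
  rw [← h2, map_wienerIntegral_orthonormal hW he,
    integral_fintype_prod_eq_prod (fun i x => Real.exp (-(b i * x + l i / 2 * (x ^ 2 - 1))))]
  simp only [fun i => integral_exp_quadratic_gaussianReal (hl i) (b i)]
  rw [Finset.prod_mul_distrib, Real.finsetProd_rpow _ _
    (fun i _ => (mul_pos (hl i) (Real.exp_pos _)).le), ← Real.exp_sum, Real.exp_add,
    Finset.mul_sum]
  ring

end Diagonal

/-! ### Diagonalization of symmetric kernels of finite rank -/

section Spectral

variable {α : Type*} [MeasurableSpace α] {m : Measure α} [SigmaFinite m]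

lemma inner_tensor_swap {K : Lp ℝ 2 (m.prod m)} (hK : ∀ᵐ p ∂m.prod m, K p.swap = K p)
    (f g : Lp ℝ 2 m) : (inner ℝ (tensor f g) K : ℝ) = inner ℝ (tensor g f) K := by
  rw [inner_tensor, inner_tensor, ← integral_prod_swap]
  refine integral_congr_ae ?_
  filter_upwards [hK] with p hp
  rw [hp, Prod.fst_swap, Prod.snd_swap, mul_comm (f p.2)]

lemma kernelOp_symm {K : Lp ℝ 2 (m.prod m)} (hK : ∀ᵐ p ∂m.prod m, K p.swap = K p)
    (f g : Lp ℝ 2 m) : (inner ℝ (kernelOp K f) g : ℝ) = inner ℝ f (kernelOp K g) := by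
  rw [real_inner_comm, inner_kernelOp, inner_kernelOp, inner_tensor_swap hK]

lemma isUnit_of_coercive {H : Type*} [NormedAddCommGroup H] [InnerProductSpace ℝ H]
    [CompleteSpace H] {T : H →L[ℝ] H} {ε : ℝ} (hε : 0 < ε)
    (hpos : ∀ x, ε * ‖x‖ ^ 2 ≤ inner ℝ x (T x)) : IsUnit T := by
  refine ContinuousLinearMap.isUnit_of_forall_le_norm_inner_map T (c := ⟨ε, hε.le⟩) hε fun x => ?_
  rw [real_inner_comm, mul_comm]
  exact (hpos x).trans (le_abs_self _)

/-- Spectral theorem on `V`. Taking `V` large enough to contain `B` may add eigenvalues `0`, which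
contribute factors `1` to the determinant. -/
lemma exists_diagonalization {K : Lp ℝ 2 (m.prod m)} (hK : ∀ᵐ p ∂m.prod m, K p.swap = K p)
    (V : Submodule ℝ (Lp ℝ 2 m)) [FiniteDimensional ℝ V] (hV : ∀ x, kernelOp K x ∈ V)
    {B : Lp ℝ 2 m} (hB : B ∈ V) :
    ∃ (n : ℕ) (e : Fin n → Lp ℝ 2 m) (b l : Fin n → ℝ), Orthonormal ℝ e ∧
      K = ∑ i, l i • tensor (e i) (e i) ∧ B = ∑ i, b i • e i ∧
      rankDet2 K = ∏ i, (1 + l i) * Real.exp (-l i) := by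
  classical
  set T : V →ₗ[ℝ] V := (kernelOp K : Lp ℝ 2 m →ₗ[ℝ] Lp ℝ 2 m).restrict fun x (_ : x ∈ V) => hV x
    with hT
  have hsym : T.IsSymmetric := fun x y => kernelOp_symm hK x y
  set v := hsym.eigenvectorBasis rfl with hv
  set l : Fin (Module.finrank ℝ V) → ℝ := hsym.eigenvalues rfl with hl
  have hTv : ∀ i, T (v i) = l i • v i := fun i => hsym.apply_eigenvectorBasis rfl i
  have hKv : ∀ i, kernelOp K (v i) = l i • (v i : Lp ℝ 2 m) := fun i =>
    congrArg Subtype.val (hTv i)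
  have hexp : ∀ x : Lp ℝ 2 m, x ∈ V → x = ∑ i, (inner ℝ (v i : Lp ℝ 2 m) x : ℝ) • (v i : Lp ℝ 2 m) := by
    intro x hx
    have h := congrArg Subtype.val (v.sum_repr' ⟨x, hx⟩)
    refine h.symm.trans ?_
    simp
  refine ⟨_, fun i => (v i : Lp ℝ 2 m), fun i => inner ℝ (v i : Lp ℝ 2 m) B, l,
    v.orthonormal.comp_linearIsometry V.subtypeₗᵢ, ?_, hexp B hB, ?_⟩
  -- A kernel is determined by its inner products with tensors, that is, by the matrix elements of
  -- its operator.
  · rw [← sub_eq_zero]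
    refine eq_zero_of_inner_tensor _ fun f g => ?_
    have h1 : kernelOp K g =
        ∑ i, (l i * inner ℝ (v i : Lp ℝ 2 m) g) • (v i : Lp ℝ 2 m) := by
      rw [hexp _ (hV g)]
      refine Finset.sum_congr rfl fun i _ => ?_
      rw [← kernelOp_symm hK, hKv, inner_smul_left]
      simp
    rw [inner_sub_right, ← inner_kernelOp, h1, inner_sum, inner_sum, sub_eq_zero]
    refine Finset.sum_congr rfl fun i _ => ?_
    rw [inner_smul_right, inner_smul_right, inner_tensor_tensor, real_inner_comm g]
    ring
  · rw [rankDet2, finiteRankDet2_eq (kernelOp K : Lp ℝ 2 m →ₗ[ℝ] Lp ℝ 2 m) V hV,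
      Finset.prod_mul_distrib, ← Real.exp_sum, Finset.sum_neg_distrib]
    congr 2
    · rw [← LinearMap.det_toMatrix v.toBasis]
      have h2 : LinearMap.toMatrix v.toBasis v.toBasis (1 + T) =
          Matrix.diagonal fun i => 1 + l i := by
        refine Matrix.ext fun i j => ?_
        have h3 : (inner ℝ (v i) ((1 + T) (v j)) : ℝ) = if i = j then 1 + l i else 0 := by
          have h4 : (1 + T) (v j) = (1 + l j) • v j := by
            rw [LinearMap.add_apply, Module.End.one_apply, hTv, add_smul, one_smul]
          have h5 : (inner ℝ (v i) ((1 + l j) • v j) : ℝ) = (1 + l j) * inner ℝ (v i) (v j) :=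
            real_inner_smul_right (v i : Lp ℝ 2 m) (v j : Lp ℝ 2 m) (1 + l j)
          rw [h4, h5, orthonormal_iff_ite.1 v.orthonormal]
          by_cases h : i = j
          · subst h; simp
          · simp [h]
        rw [LinearMap.toMatrix_apply, OrthonormalBasis.coe_toBasis,
          OrthonormalBasis.coe_toBasis_repr_apply, v.repr_apply_apply, h3, Matrix.diagonal_apply]
      rw [h2, Matrix.det_diagonal]
    · rw [LinearMap.IsSymmetric.trace_eq_sum_eigenvalues rfl hsym]
      rfl

lemma inner_inverse_diagonal {n : ℕ} {e : Fin n → Lp ℝ 2 m} (he : Orthonormal ℝ e)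
    (b l : Fin n → ℝ) (hl : ∀ i, 0 < 1 + l i)
    (hu : IsUnit (1 + kernelOp (∑ i, l i • tensor (e i) (e i)))) :
    (inner ℝ (∑ i, b i • e i) (Ring.inverse (1 + kernelOp (∑ i, l i • tensor (e i) (e i)))
      (∑ i, b i • e i)) : ℝ) = ∑ i, b i ^ 2 / (1 + l i) := by
  classical
  set K := ∑ i, l i • tensor (e i) (e i) with hK
  have hKe : ∀ i, kernelOp K (e i) = l i • e i := by
    intro i
    refine ext_inner_left ℝ fun f => ?_
    rw [inner_kernelOp, hK, inner_sum, Finset.sum_eq_single i]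
    · rw [inner_smul_right, inner_smul_right, inner_tensor_tensor, orthonormal_iff_ite.1 he]
      simp
    · intro j _ hj
      rw [inner_smul_right, inner_tensor_tensor, orthonormal_iff_ite.1 he, if_neg hj.symm]
      simp
    · simp
  -- The inverse is not computed; an explicit preimage of `B` under `1 + K` suffices.
  have h1 : (1 + kernelOp K) (∑ i, (b i / (1 + l i)) • e i) = ∑ i, b i • e i := by
    rw [map_sum]
    refine Finset.sum_congr rfl fun i _ => ?_
    rw [map_smul, add_apply, one_apply_eq_self, hKe, smul_add, smul_smul, ← add_smul]
    congr 1
    have := (hl i).ne'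
    field_simp
  have h2 : Ring.inverse (1 + kernelOp K) (∑ i, b i • e i) =
      ∑ i, (b i / (1 + l i)) • e i := by
    rw [← h1, ← mul_apply_eq_comp, Ring.inverse_mul_cancel _ hu,
      one_apply_eq_self]
  rw [h2, he.inner_sum]
  refine Finset.sum_congr rfl fun i _ => ?_
  simp only [conj_trivial]
  ring

end Spectral

/-! ### The exponential formula for finite rank kernels -/

section FiniteRankFormula

variable {Ω : Type*} [MeasurableSpace Ω] {P : Measure Ω} [IsProbabilityMeasure P] {N : ℕ}
  {W : Fin N → ℝ≥0 → Ω → ℝ}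

/-- The quadratic formula for symmetric kernels of finite rank. -/
lemma integral_exp_neg_quadVar_finiteRank (hW : IsBrownianMotion W P) (A : ℝ) (B : L2 N)
    {K : Kernel2 N} (hK : ∀ᵐ p ∂(idxMeasure N).prod (idxMeasure N), K p.swap = K p)
    (hfin : K ∈ finiteRankKernels (idxMeasure N)) {ε : ℝ} (hε : 0 < ε)
    (hpos : ∀ x, ε * ‖x‖ ^ 2 ≤ inner ℝ x ((1 + kernelOp K) x)) :
    ∫ ω, Real.exp (-quadVar W P A B K ω) ∂P = rankDet2 K ^ (-(1 / 2) : ℝ) *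
      Real.exp (-A + 1 / 2 * inner ℝ B (Ring.inverse (1 + kernelOp K) B)) := by
  have : FiniteDimensional ℝ (LinearMap.range (kernelOp K : L2 N →ₗ[ℝ] L2 N)) := hfin
  have : FiniteDimensional ℝ (Submodule.span ℝ {B}) :=
    FiniteDimensional.span_of_finite ℝ (Set.toFinite _)
  obtain ⟨n, e, b, l, he, hKe, hBe, hdet⟩ := exists_diagonalization hK
    (LinearMap.range (kernelOp K : L2 N →ₗ[ℝ] L2 N) ⊔ Submodule.span ℝ {B})
    (fun x => Submodule.mem_sup_left ⟨x, rfl⟩)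
    (Submodule.mem_sup_right (Submodule.mem_span_singleton_self B))
  have hu := isUnit_of_coercive hε hpos
  -- Evaluate the coercivity bound at the unit eigenvector `e i`, where the form equals `1 + l i`.
  have hl : ∀ i, 0 < 1 + l i := by
    classical
    intro i
    have h := hpos (e i)
    rw [add_apply, one_apply_eq_self, inner_add_right, inner_kernelOp,
      real_inner_self_eq_norm_sq, he.1 i, hKe, inner_sum, Finset.sum_eq_single i] at h
    · rw [inner_smul_right, inner_tensor_tensor, real_inner_self_eq_norm_sq, he.1 i] at h
      linarith
    · intro j _ hj
      rw [inner_smul_right, inner_tensor_tensor, he.2 hj.symm]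
      simp
    · simp
  rw [hdet]
  rw [hKe] at hu ⊢
  rw [hBe, inner_inverse_diagonal he b l hl hu]
  exact integral_exp_neg_quadVar_diagonal hW A he b l hl

end FiniteRankFormula

/-! ### Coercivity from positivity of the spectrum -/

section Coercive

variable {H : Type*} [NormedAddCommGroup H] [InnerProductSpace ℝ H]

/-- Expand the nonnegative form at `x - t S x` with `t = 1 / (‖S‖ + 1)`; adding `1` avoids a
separate case for `S = 0`. -/
lemma norm_sq_le_of_nonneg {S : H →L[ℝ] H} (hs : ∀ x y, (inner ℝ (S x) y : ℝ) = inner ℝ x (S y))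
    (h0 : ∀ x, (0 : ℝ) ≤ inner ℝ x (S x)) (x : H) :
    ‖S x‖ ^ 2 ≤ (‖S‖ + 1) * inner ℝ x (S x) := by
  have hc : 0 < ‖S‖ + 1 := by positivity
  set t : ℝ := (‖S‖ + 1)⁻¹ with ht
  have h1 := h0 (x - t • S x)
  have h2 : (inner ℝ (S x) (S (S x)) : ℝ) ≤ (‖S‖ + 1) * ‖S x‖ ^ 2 := by
    calc (inner ℝ (S x) (S (S x)) : ℝ) ≤ ‖S x‖ * ‖S (S x)‖ := real_inner_le_norm _ _
      _ ≤ ‖S x‖ * (‖S‖ * ‖S x‖) := by gcongr; exact S.le_opNorm _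
      _ ≤ _ := by nlinarith [sq_nonneg ‖S x‖]
  have h3 : (inner ℝ (x - t • S x) (S (x - t • S x)) : ℝ) =
      inner ℝ x (S x) - 2 * t * ‖S x‖ ^ 2 + t ^ 2 * inner ℝ (S x) (S (S x)) := by
    rw [map_sub, map_smul, inner_sub_left, inner_sub_right, inner_sub_right, inner_smul_left,
      inner_smul_left, inner_smul_right, inner_smul_right, ← hs x (S x),
      real_inner_self_eq_norm_sq]
    simp only [conj_trivial]
    ring
  have h4 : t ^ 2 * (inner ℝ (S x) (S (S x)) : ℝ) ≤ t * ‖S x‖ ^ 2 := by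
    calc t ^ 2 * (inner ℝ (S x) (S (S x)) : ℝ) ≤ t ^ 2 * ((‖S‖ + 1) * ‖S x‖ ^ 2) := by gcongr
      _ = t * (t * (‖S‖ + 1)) * ‖S x‖ ^ 2 := by ring
      _ = _ := by rw [ht, inv_mul_cancel₀ hc.ne', mul_one]
  have h5 : t * ‖S x‖ ^ 2 ≤ inner ℝ x (S x) := by linarith
  rwa [ht, inv_mul_le_iff₀ hc] at h5

/-- A symmetric operator with positive spectrum is coercive. -/
lemma exists_coercive {T : H →L[ℝ] H} (hs : ∀ x y, (inner ℝ (T x) y : ℝ) = inner ℝ x (T y))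
    (hpos : ∀ r ∈ spectrum ℝ T, 0 < r) :
    ∃ ε : ℝ, 0 < ε ∧ ∀ x, ε * ‖x‖ ^ 2 ≤ inner ℝ x (T x) := by
  rcases subsingleton_or_nontrivial H with hH | hH
  · exact ⟨1, one_pos, fun x => by simp [Subsingleton.elim x 0]⟩
  set R : Set ℝ := (fun x => (inner ℝ x (T x) : ℝ)) '' Metric.sphere 0 1 with hR
  have hne : R.Nonempty := ((NormedSpace.sphere_nonempty (E := H)).2 zero_le_one).image _
  have hbdd : BddBelow R := by
    refine ⟨-‖T‖, ?_⟩
    rintro _ ⟨x, hx, rfl⟩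
    have hx1 : ‖x‖ = 1 := by simpa using hx
    have h := (abs_real_inner_le_norm x (T x)).trans
      (mul_le_mul_of_nonneg_left (T.le_opNorm x) (norm_nonneg x))
    rw [hx1] at h
    have := neg_le_of_abs_le h
    simpa using this
  set r := sInf R with hr
  have hle : ∀ x, r * ‖x‖ ^ 2 ≤ inner ℝ x (T x) := by
    intro x
    rcases eq_or_ne x 0 with rfl | hx
    · simp
    have hx' : 0 < ‖x‖ := norm_pos_iff.2 hx
    have h := csInf_le hbdd ⟨(‖x‖)⁻¹ • x, by simp [norm_smul, hx'.ne'], rfl⟩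
    simp only [map_smul, inner_smul_left, inner_smul_right, conj_trivial] at h
    rw [← hr, ← mul_assoc, ← sq, inv_pow, ← div_eq_inv_mul, le_div_iff₀ (by positivity)] at h
    exact h
  -- The infimum `r` of the form on the unit sphere is a spectral value. Otherwise `S = T - r` is
  -- nonnegative and invertible, so `⟨x, S x⟩` is bounded below by a multiple of `‖x‖²`,
  -- contradicting near-minimizers.
  refine ⟨r, hpos r ?_, hle⟩
  rw [spectrum.mem_iff]
  intro hu
  set S : H →L[ℝ] H := T - algebraMap ℝ (H →L[ℝ] H) r with hS
  have hu' : IsUnit S := by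
    rw [hS, ← neg_sub]
    exact hu.neg
  have hSx : ∀ x, S x = T x - r • x := fun x => by
    rw [hS, Algebra.algebraMap_eq_smul_one]; rfl
  have hSs : ∀ x y, (inner ℝ (S x) y : ℝ) = inner ℝ x (S y) := fun x y => by
    rw [hSx, hSx, inner_sub_left, inner_sub_right, hs, inner_smul_left, inner_smul_right]
    simp
  have hSn : ∀ x, (inner ℝ x (S x) : ℝ) = inner ℝ x (T x) - r * ‖x‖ ^ 2 := fun x => by
    rw [hSx, inner_sub_right, inner_smul_right, real_inner_self_eq_norm_sq]
  have hS0 : ∀ x, (0 : ℝ) ≤ inner ℝ x (S x) := fun x => by rw [hSn]; linarith [hle x]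
  set Q : H →L[ℝ] H := Ring.inverse S with hQ
  have hQS : ∀ x, Q (S x) = x := fun x => by
    rw [← mul_apply_eq_comp, Ring.inverse_mul_cancel _ hu', one_apply_eq_self]
  set c : ℝ := ‖Q‖ ^ 2 * (‖S‖ + 1) with hc
  have hc0 : 0 ≤ c := by positivity
  have hbound : ∀ x, ‖x‖ ^ 2 ≤ c * inner ℝ x (S x) := by
    intro x
    calc ‖x‖ ^ 2 = ‖Q (S x)‖ ^ 2 := by rw [hQS]
      _ ≤ (‖Q‖ * ‖S x‖) ^ 2 := by gcongr; exact Q.le_opNorm _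
      _ = ‖Q‖ ^ 2 * ‖S x‖ ^ 2 := by ring
      _ ≤ ‖Q‖ ^ 2 * ((‖S‖ + 1) * inner ℝ x (S x)) := by
          gcongr; exact norm_sq_le_of_nonneg hSs hS0 x
      _ = _ := by rw [hc]; ring
  -- With this margin a near-minimizer `x` would satisfy `1 ≤ c / (c + 1)`; the `+ 1` also covers `c
  -- = 0`.
  have hlt : r < r + (c + 1)⁻¹ := by
    have : 0 < (c + 1)⁻¹ := by positivity
    linarith
  obtain ⟨_, ⟨x, hx, rfl⟩, hxr⟩ := exists_lt_of_csInf_lt hne hlt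
  have hx1 : ‖x‖ = 1 := by simpa using hx
  have h1 := hbound x
  rw [hSn, hx1] at h1
  simp only at hxr
  have h2 : c * ((inner ℝ x (T x) : ℝ) - r * 1 ^ 2) ≤ c * (c + 1)⁻¹ :=
    mul_le_mul_of_nonneg_left (by linarith) hc0
  have h3 : c * (c + 1)⁻¹ < 1 := by
    rw [← div_eq_mul_inv, div_lt_one (by linarith)]
    linarith
  linarith

lemma norm_inverse_apply_le {T : H →L[ℝ] H} (hu : IsUnit T) {ε : ℝ} (hε : 0 < ε)
    (hpos : ∀ x, ε * ‖x‖ ^ 2 ≤ inner ℝ x (T x)) (y : H) : ‖Ring.inverse T y‖ ≤ ‖y‖ / ε := by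
  set x := Ring.inverse T y with hx
  have hTx : T x = y := by
    rw [hx, ← mul_apply_eq_comp, Ring.mul_inverse_cancel _ hu, one_apply_eq_self]
  have h := (hpos x).trans (real_inner_le_norm _ _)
  rw [hTx] at h
  rw [le_div_iff₀ hε]
  rcases (norm_nonneg x).eq_or_lt with h0 | h0
  · rw [← h0, zero_mul]; exact norm_nonneg y
  · nlinarith

end Coercive

/-! ### Approximation by symmetric kernels of finite rank -/

section Approx

variable {α : Type*} [MeasurableSpace α] {m : Measure α} [SigmaFinite m]

/-- The kernel `(x, y) ↦ K (y, x)`. -/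
def swapKernel (m : Measure α) [SigmaFinite m] : Lp ℝ 2 (m.prod m) →ₗᵢ[ℝ] Lp ℝ 2 (m.prod m) :=
  Lp.compMeasurePreservingₗᵢ ℝ Prod.swap Measure.measurePreserving_swap

lemma coeFn_swapKernel (K : Lp ℝ 2 (m.prod m)) :
    swapKernel m K =ᵐ[m.prod m] fun p => K p.swap :=
  Lp.coeFn_compMeasurePreserving K Measure.measurePreserving_swap

lemma swapKernel_eq_iff {K : Lp ℝ 2 (m.prod m)} :
    swapKernel m K = K ↔ ∀ᵐ p ∂m.prod m, K p.swap = K p := by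
  constructor
  · intro h
    filter_upwards [coeFn_swapKernel K] with p hp
    rw [← hp, h]
  · intro h
    exact Lp.ext ((coeFn_swapKernel K).trans h)

lemma ae_swap {p : α × α → Prop} (h : ∀ᵐ z ∂m.prod m, p z) : ∀ᵐ z ∂m.prod m, p z.swap :=
  (Measure.measurePreserving_swap (μ := m) (ν := m)).quasiMeasurePreserving.ae h

lemma swapKernel_swapKernel (K : Lp ℝ 2 (m.prod m)) : swapKernel m (swapKernel m K) = K := by
  refine Lp.ext ?_
  filter_upwards [coeFn_swapKernel (swapKernel m K), ae_swap (coeFn_swapKernel K)] with p h1 h2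
  rw [h1, h2, Prod.swap_swap]

lemma swapKernel_tensor (f g : Lp ℝ 2 m) : swapKernel m (tensor f g) = tensor g f := by
  refine Lp.ext ?_
  filter_upwards [coeFn_swapKernel (tensor f g), ae_swap (coeFn_tensor f g),
    coeFn_tensor g f] with p h1 h2 h3
  rw [h1, h2, h3, Prod.fst_swap, Prod.snd_swap, mul_comm]

lemma swapKernel_mem_span {K : Lp ℝ 2 (m.prod m)}
    (hK : K ∈ Submodule.span ℝ (Set.range fun p : Lp ℝ 2 m × Lp ℝ 2 m => tensor p.1 p.2)) :
    swapKernel m K ∈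
      Submodule.span ℝ (Set.range fun p : Lp ℝ 2 m × Lp ℝ 2 m => tensor p.1 p.2) := by
  induction hK using Submodule.span_induction with
  | mem K hK =>
    obtain ⟨⟨f, g⟩, rfl⟩ := hK
    rw [swapKernel_tensor]
    exact Submodule.subset_span ⟨(g, f), rfl⟩
  | zero => rw [map_zero]; exact Submodule.zero_mem _
  | add K L _ _ hK hL => rw [map_add]; exact Submodule.add_mem _ hK hL
  | smul c K _ hK => rw [map_smul]; exact Submodule.smul_mem _ c hK

/-- Average a finite tensor sum with its transpose. Transposition is an isometry fixing `C`, so the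
error does not increase. -/
lemma exists_symm_finiteRank_near {C : Lp ℝ 2 (m.prod m)}
    (hC : ∀ᵐ p ∂m.prod m, C p.swap = C p) {δ : ℝ} (hδ : 0 < δ) :
    ∃ K ∈ finiteRankKernels m, (∀ᵐ p ∂m.prod m, K p.swap = K p) ∧ ‖K - C‖ < δ := by
  obtain ⟨L, hL, hLC⟩ := Metric.mem_closure_iff.1 (mem_closure_span_tensor C) δ hδ
  rw [dist_eq_norm, norm_sub_rev] at hLC
  refine ⟨(1 / 2 : ℝ) • (L + swapKernel m L), ?_, ?_, ?_⟩
  · obtain ⟨V, _, hV⟩ := exists_subspace_of_mem_span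
      (Submodule.smul_mem _ (1 / 2 : ℝ) (Submodule.add_mem _ hL (swapKernel_mem_span hL)))
    exact finiteRankKernels_of_forall_mem V (kernelOp_mem_of_mem_span hV)
  · rw [← swapKernel_eq_iff, map_smul, map_add, swapKernel_swapKernel, add_comm]
  · have h1 : (1 / 2 : ℝ) • (L + swapKernel m L) - C =
        (1 / 2 : ℝ) • ((L - C) + swapKernel m (L - C)) := by
      rw [map_sub, swapKernel_eq_iff.2 hC]
      module
    calc ‖(1 / 2 : ℝ) • (L + swapKernel m L) - C‖
        ≤ 1 / 2 * (‖L - C‖ + ‖swapKernel m (L - C)‖) := by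
          rw [h1, norm_smul]
          gcongr
          · norm_num
          · exact norm_add_le _ _
      _ = ‖L - C‖ := by rw [LinearIsometry.norm_map]; ring
      _ < δ := hLC

end Approx

/-! ### Passage to the limit -/

/-- An `L^q` bound with `q > 1` gives uniform integrability by Hölder, and Vitali's theorem gives
convergence; Fatou makes the limit integrable. -/
lemma tendsto_integral_of_eLpNorm_le {Ω : Type*} [MeasurableSpace Ω] {P : Measure Ω}
    [IsProbabilityMeasure P] {f : ℕ → Ω → ℝ} {g : Ω → ℝ} (hf : ∀ n, AEStronglyMeasurable (f n) P)
    (hg : AEStronglyMeasurable g P) {q c : ℝ} (hq : 1 < q) (hc : 0 < c)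
    (hbound : ∀ n, eLpNorm (f n) (ENNReal.ofReal q) P ≤ ENNReal.ofReal c)
    (hfg : ∀ᵐ ω ∂P, Filter.Tendsto (fun n => f n ω) Filter.atTop (nhds (g ω))) :
    Integrable g P ∧
      Filter.Tendsto (fun n => ∫ ω, f n ω ∂P) Filter.atTop (nhds (∫ ω, g ω ∂P)) := by
  have hq1 : (1 : ℝ≥0∞) ≤ ENNReal.ofReal q := by
    rw [← ENNReal.ofReal_one]; exact ENNReal.ofReal_le_ofReal hq.le
  have hb1 : ∀ n, eLpNorm (f n) 1 P ≤ ENNReal.ofReal c := fun n =>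
    (eLpNorm_le_eLpNorm_of_exponent_le hq1 (hf n)).trans (hbound n)
  have hg1 : MemLp g 1 P := by
    refine ⟨hg, ((Lp.eLpNorm_lim_le_liminf_eLpNorm hf g hfg).trans ?_).trans_lt
      (ENNReal.ofReal_lt_top (r := c))⟩
    exact Filter.liminf_le_of_frequently_le' (Filter.Frequently.of_forall hb1)
  set r : ℝ := 1 - 1 / q with hr
  have hr0 : 0 < r := by
    rw [hr, sub_pos, div_lt_one (by linarith)]; exact hq
  have hui : UnifIntegrable f 1 P := by
    intro η hη
    -- Hölder on a set of measure at most `d` gives `c * d ^ r` with `r = 1 - 1 / q`; this `d` makes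
    -- it equal to `η`.
    refine ⟨(η / c) ^ (1 / r), by positivity, fun n s hs hPs => ?_⟩
    rw [eLpNorm_indicator_eq_eLpNorm_restrict hs]
    calc eLpNorm (f n) 1 (P.restrict s)
        ≤ eLpNorm (f n) (ENNReal.ofReal q) (P.restrict s) *
            (P.restrict s) Set.univ ^ (1 / (1 : ℝ≥0∞).toReal - 1 / (ENNReal.ofReal q).toReal) :=
          eLpNorm_le_eLpNorm_mul_rpow_measure_univ hq1 (hf n).restrict
      _ ≤ ENNReal.ofReal c * ENNReal.ofReal ((η / c) ^ (1 / r)) ^ r := by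
          rw [Measure.restrict_apply_univ, ENNReal.toReal_ofReal (by linarith),
            ENNReal.toReal_one, div_one, ← hr]
          gcongr
          exact (eLpNorm_mono_measure _ Measure.restrict_le_self).trans (hbound n)
      _ = ENNReal.ofReal η := by
          rw [ENNReal.ofReal_rpow_of_pos (by positivity), ← ENNReal.ofReal_mul hc.le,
            ← Real.rpow_mul (by positivity), one_div, inv_mul_cancel₀ hr0.ne', Real.rpow_one,
            mul_div_cancel₀ _ hc.ne']
  refine ⟨memLp_one_iff_integrable.1 hg1, ?_⟩
  refine tendsto_integral_of_L1' g hg (Filter.Eventually.of_forall fun n => ?_)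
    (tendsto_Lp_finite_of_tendsto_ae le_rfl ENNReal.one_ne_top hf hg1 hui hfg)
  exact memLp_one_iff_integrable.1 ⟨hf n, (hb1 n).trans_lt ENNReal.ofReal_lt_top⟩

section Limit

variable {Ω : Type*} [MeasurableSpace Ω] {P : Measure Ω} [IsProbabilityMeasure P] {N : ℕ}
  {W : Fin N → ℝ≥0 → Ω → ℝ}

lemma measurable_quadVar (A : ℝ) (B : L2 N) (C : Kernel2 N) :
    Measurable (quadVar W P A B C) :=
  ((measurable_Lp (wienerIntegral W P B)).const_add A).add
    (measurable_Lp (iteratedIntegral W P (restrictSimplex C)))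

/-- `Y` is linear in `(A, B, C)` jointly, so a `q`-th moment of `exp (-Y)` is a first moment for the
scaled data. -/
lemma quadVar_smul (hW : IsBrownianMotion W P) (q A : ℝ) (B : L2 N) (C : Kernel2 N) :
    quadVar W P (q * A) (q • B) (q • C) =ᵐ[P] fun ω => q * quadVar W P A B C ω := by
  have h : iteratedIntegral W P (restrictSimplex (q • C)) =
      q • iteratedIntegral W P (restrictSimplex C) := by
    rw [restrictSimplex_smul, ← iteratedₗ_apply hW, map_smul, iteratedₗ_apply]
  filter_upwards [Lp.coeFn_smul q (wienerIntegral W P B),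
    Lp.coeFn_smul q (iteratedIntegral W P (restrictSimplex C))] with ω h1 h2
  rw [quadVar, quadVar, h, wienerIntegral_smul hW, h1, h2, Pi.smul_apply, Pi.smul_apply,
    smul_eq_mul, smul_eq_mul]
  ring

/-- Bound on the exponential moment in terms of a coercivity constant and norms. -/
lemma integral_exp_neg_quadVar_le (hW : IsBrownianMotion W P) (A : ℝ) (B : L2 N)
    {K : Kernel2 N} (hK : ∀ᵐ p ∂(idxMeasure N).prod (idxMeasure N), K p.swap = K p)
    (hfin : K ∈ finiteRankKernels (idxMeasure N)) {ε R : ℝ} (hε : 0 < ε)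
    (hpos : ∀ x, ε * ‖x‖ ^ 2 ≤ inner ℝ x ((1 + kernelOp K) x)) (hR : ‖K‖ ≤ R) :
    Integrable (fun ω => Real.exp (-quadVar W P A B K ω)) P ∧
    ∫ ω, Real.exp (-quadVar W P A B K ω) ∂P ≤
      Real.exp ((R / ε) ^ 2 / 2 + R * (R / ε)) ^ (1 / 2 : ℝ) *
        Real.exp (-A + 1 / 2 * (‖B‖ * (‖B‖ / ε))) := by
  have h := integral_exp_neg_quadVar_finiteRank hW A B hK hfin hε hpos
  have hdpos := rankDet2_pos hfin hε hpos
  -- The formula gives a positive value, while a non-integrable function would have integral `0`;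
  -- integrability follows without separate estimates.
  refine ⟨not_imp_comm.1 integral_undef ?_, ?_⟩
  · rw [h]
    positivity
  · rw [h]
    have hop0 : kernelOp (0 : Kernel2 N) = 0 := by simpa using kernelOp_smul 0 (0 : Kernel2 N)
    have h0 : (0 : Kernel2 N) ∈ finiteRankKernels (idxMeasure N) :=
      finiteRankKernels_of_forall_mem ⊥ fun x => by rw [hop0]; rfl
    have h1 : rankDet2 (0 : Kernel2 N) = 1 := by
      rw [rankDet2, finiteRankDet2_eq (kernelOp (0 : Kernel2 N) : L2 N →ₗ[ℝ] L2 N) ⊥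
        fun x => by rw [hop0]; rfl]
      have hz : ((kernelOp (0 : Kernel2 N) : L2 N →ₗ[ℝ] L2 N).restrict
          fun x (_ : x ∈ (⊥ : Submodule ℝ (L2 N))) =>
            (by rw [hop0]; rfl : kernelOp (0 : Kernel2 N) x ∈ (⊥ : Submodule ℝ (L2 N)))) = 0 :=
        Subsingleton.elim _ _
      rw [hz]
      simp
    -- Comparison with the zero kernel, whose determinant is `1`, bounds the determinant of `K` away
    -- from `0`.
    have h2 := rankDet2_le h0 hfin hε hpos
    rw [h1, zero_sub, norm_neg] at h2
    have h3 : (rankDet2 K)⁻¹ ≤ Real.exp ((R / ε) ^ 2 / 2 + R * (R / ε)) := by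
      rw [inv_le_iff_one_le_mul₀ hdpos, mul_comm]
      have hR0 : 0 ≤ R := (norm_nonneg K).trans hR
      refine h2.trans ?_
      gcongr
    have h4 : rankDet2 K ^ (-(1 / 2) : ℝ) ≤
        Real.exp ((R / ε) ^ 2 / 2 + R * (R / ε)) ^ (1 / 2 : ℝ) := by
      rw [Real.rpow_neg hdpos.le, ← Real.inv_rpow hdpos.le]
      exact Real.rpow_le_rpow (inv_nonneg.2 hdpos.le) h3 (by norm_num)
    have h5 : (inner ℝ B (Ring.inverse (1 + kernelOp K) B) : ℝ) ≤ ‖B‖ * (‖B‖ / ε) :=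
      (real_inner_le_norm _ _).trans (mul_le_mul_of_nonneg_left
        (norm_inverse_apply_le (isUnit_of_coercive hε hpos) hε hpos B) (norm_nonneg _))
    gcongr

lemma eLpNorm_exp_neg {X : Ω → ℝ} {q : ℝ} (hq : 0 < q)
    (hi : Integrable (fun ω => Real.exp (-(q * X ω))) P) :
    eLpNorm (fun ω => Real.exp (-X ω)) (ENNReal.ofReal q) P =
      ENNReal.ofReal ((∫ ω, Real.exp (-(q * X ω)) ∂P) ^ (1 / q)) := by
  rw [eLpNorm_eq_lintegral_rpow_enorm_toReal (by simpa using hq) ENNReal.ofReal_ne_top,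
    ENNReal.toReal_ofReal hq.le, ← ENNReal.ofReal_rpow_of_nonneg
      (integral_nonneg fun _ => (Real.exp_pos _).le) (by positivity),
    ofReal_integral_eq_lintegral_ofReal hi
      (Filter.Eventually.of_forall fun _ => (Real.exp_pos _).le)]
  congr 1
  refine lintegral_congr fun ω => ?_
  rw [Real.enorm_of_nonneg (Real.exp_pos _).le, ENNReal.ofReal_rpow_of_pos (Real.exp_pos _),
    ← Real.exp_mul]
  congr 2
  ring

/-- Hilbert–Schmidt convergence implies operator norm convergence, and inversion is continuous at a
unit. -/
lemma tendsto_inner_inverse {K : ℕ → Kernel2 N} {C : Kernel2 N} (B : L2 N)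
    (hu : IsUnit (1 + kernelOp C)) (hK : Filter.Tendsto K Filter.atTop (nhds C)) :
    Filter.Tendsto (fun n => (inner ℝ B (Ring.inverse (1 + kernelOp (K n)) B) : ℝ)) Filter.atTop
      (nhds (inner ℝ B (Ring.inverse (1 + kernelOp C) B))) := by
  have h1 : Filter.Tendsto (fun n => 1 + kernelOp (K n)) Filter.atTop
      (nhds (1 + kernelOp C)) := by
    refine Filter.Tendsto.const_add 1 ?_
    rw [tendsto_iff_norm_sub_tendsto_zero] at hK ⊢
    refine squeeze_zero (fun _ => norm_nonneg _) (fun n => ?_) hK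
    rw [← kernelOp_sub]
    exact norm_kernelOp_le _
  obtain ⟨u, hu⟩ := hu
  have h2 := NormedRing.inverse_continuousAt u
  rw [hu] at h2
  have h3 : Filter.Tendsto (fun n => Ring.inverse (1 + kernelOp (K n)) B) Filter.atTop
      (nhds (Ring.inverse (1 + kernelOp C) B)) :=
    ((ContinuousLinearMap.apply ℝ (L2 N) B).continuous.tendsto _).comp (h2.tendsto.comp h1)
  exact tendsto_const_nhds.inner h3

/-- The iterated integral is isometric and restriction to the simplex contractive, so `L²`
convergence holds; a subsequence converges almost surely. -/
lemma exists_subseq_tendsto_quadVar (hW : IsBrownianMotion W P) (A : ℝ) (B : L2 N)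
    {K : ℕ → Kernel2 N} {C : Kernel2 N} (hK : Filter.Tendsto K Filter.atTop (nhds C)) :
    ∃ s : ℕ → ℕ, StrictMono s ∧ ∀ᵐ ω ∂P, Filter.Tendsto (fun n => quadVar W P A B (K (s n)) ω)
      Filter.atTop (nhds (quadVar W P A B C ω)) := by
  have h1 : Filter.Tendsto (fun n => iteratedIntegral W P (restrictSimplex (K n))) Filter.atTop
      (nhds (iteratedIntegral W P (restrictSimplex C))) := by
    rw [tendsto_iff_norm_sub_tendsto_zero] at hK ⊢
    refine squeeze_zero (fun _ => norm_nonneg _) (fun n => ?_) hK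
    rw [← iteratedₗ_apply hW, ← iteratedₗ_apply hW, ← map_sub, ← restrictₗ_apply,
      ← restrictₗ_apply, ← map_sub, iteratedₗ_apply, norm_iteratedIntegral hW]
    exact norm_restrictSimplex_le _
  obtain ⟨s, hs, h2⟩ := (tendstoInMeasure_of_tendsto_Lp h1).exists_seq_tendsto_ae
  refine ⟨s, hs, ?_⟩
  filter_upwards [h2] with ω hω
  exact hω.const_add _

end Limit

end QuadExp

end

/-! ### The formula for general symmetric kernels -/

theorem proposition4p1 {Ω : Type*} [MeasurableSpace Ω] (P : Measure Ω) [IsProbabilityMeasure P]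
    {N : ℕ} (W : Fin N → ℝ≥0 → Ω → ℝ) (hW : QuadExp.IsBrownianMotion W P)
    (A : ℝ) (B : QuadExp.L2 N) (C : QuadExp.Kernel2 N)
    (hsymm : ∀ᵐ p ∂((QuadExp.idxMeasure N).prod (QuadExp.idxMeasure N)), C p.swap = C p)
    (hpos : ∀ x ∈ spectrum ℝ (1 + QuadExp.kernelOp C), 0 < x) :
    Integrable (fun ω => Real.exp (-QuadExp.quadVar W P A B C ω)) P ∧
      ∫ ω, Real.exp (-QuadExp.quadVar W P A B C ω) ∂P =
        QuadExp.det2 C ^ (-(1 / 2) : ℝ) *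
          Real.exp (-A + 1 / 2 * inner ℝ B (Ring.inverse (1 + QuadExp.kernelOp C) B)) := by
  open QuadExp in
  have hTs : ∀ x y : L2 N, (inner ℝ ((1 + kernelOp C) x) y : ℝ) =
      inner ℝ x ((1 + kernelOp C) y) := fun x y => by
    rw [add_apply, add_apply, inner_add_left, inner_add_right, kernelOp_symm hsymm]
    rfl
  obtain ⟨ε₀, hε₀, hco₀⟩ := exists_coercive hTs hpos
  obtain ⟨hdet, hlim⟩ := tendsto_rankDet2 C hε₀ hco₀
  set ε : ℝ := ε₀ / 2 with hεdef
  have hε : 0 < ε := half_pos hε₀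
  -- The bound `ε = ε₀ / 2` keeps every `1 + K n` coercive with constant `ε`; the bound `1 / (n +
  -- 1)` forces convergence.
  have hδ : ∀ n : ℕ, 0 < min ε (1 / ((n : ℝ) + 1)) := fun n => lt_min hε (by positivity)
  choose K hKfin hKsymm hKC using fun n => exists_symm_finiteRank_near hsymm (hδ n)
  have hKt : Filter.Tendsto K Filter.atTop (nhds C) := by
    rw [tendsto_iff_norm_sub_tendsto_zero]
    exact squeeze_zero (fun _ => norm_nonneg _) (fun n => (hKC n).le.trans (min_le_right _ _))
      tendsto_one_div_add_atTop_nhds_zero_nat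
  have hco : ∀ n x, ε * ‖x‖ ^ 2 ≤ inner ℝ x ((1 + kernelOp (K n)) x) := fun n x => by
    have h := coercive_of_norm_sub_le hco₀ ((hKC n).le.trans (min_le_left _ _)) x
    rwa [hεdef, sub_half] at h
  have hKn : ∀ n, ‖K n‖ ≤ ‖C‖ + 1 := fun n => by
    have h1 := (hKC n).le.trans (min_le_right _ _)
    have h2 : 1 / ((n : ℝ) + 1) ≤ 1 := by
      rw [div_le_one (by positivity)]; linarith [Nat.cast_nonneg (α := ℝ) n]
    have h3 := norm_le_norm_add_norm_sub' (K n) C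
    linarith
  -- An exponent `q > 1` for which `1 + q K n` is still uniformly coercive.
  set κ : ℝ := min ε 1 with hκ
  have hκ0 : 0 < κ := lt_min hε one_pos
  set q : ℝ := 1 + κ / 2 with hq
  have hq1 : 1 < q := by linarith
  -- Since `1 + q K = q (1 + K) - (q - 1)`, the form is at least `q κ - κ / 2 = κ / 2 + κ² / 2`
  -- times `‖x‖²`.
  have hqco : ∀ n x, κ / 2 * ‖x‖ ^ 2 ≤ inner ℝ x ((1 + kernelOp (q • K n)) x) := fun n x => by
    have h := hco n x
    rw [add_apply, one_apply_eq_self, inner_add_right, real_inner_self_eq_norm_sq] at h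
    rw [kernelOp_smul, add_apply, one_apply_eq_self, inner_add_right, real_inner_self_eq_norm_sq,
      smul_apply, inner_smul_right]
    have h1 : κ * ‖x‖ ^ 2 ≤ ε * ‖x‖ ^ 2 :=
      mul_le_mul_of_nonneg_right (min_le_left _ _) (sq_nonneg _)
    have h2 : 0 ≤ κ ^ 2 * ‖x‖ ^ 2 := by positivity
    have h3 : q * (κ * ‖x‖ ^ 2) ≤ q * (‖x‖ ^ 2 + inner ℝ x (kernelOp (K n) x)) :=
      mul_le_mul_of_nonneg_left (h1.trans h) (by linarith)
    rw [hq] at h3 ⊢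
    nlinarith
  have hqfin : ∀ n, q • K n ∈ finiteRankKernels (idxMeasure N) := fun n => by
    have : FiniteDimensional ℝ (LinearMap.range (kernelOp (K n) : L2 N →ₗ[ℝ] L2 N)) := hKfin n
    refine finiteRankKernels_of_forall_mem
      (LinearMap.range (kernelOp (K n) : L2 N →ₗ[ℝ] L2 N)) fun x => ?_
    rw [kernelOp_smul]
    exact Submodule.smul_mem _ q ⟨x, rfl⟩
  have hqsymm : ∀ n, ∀ᵐ p ∂(idxMeasure N).prod (idxMeasure N),
      (q • K n : Kernel2 N) p.swap = (q • K n : Kernel2 N) p := fun n => by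
    rw [← swapKernel_eq_iff, map_smul, swapKernel_eq_iff.2 (hKsymm n)]
  have hqn : ∀ n, ‖q • K n‖ ≤ q * (‖C‖ + 1) := fun n => by
    rw [norm_smul, Real.norm_of_nonneg (by linarith)]
    exact mul_le_mul_of_nonneg_left (hKn n) (by linarith)
  have hmom := fun n => integral_exp_neg_quadVar_le hW (q * A) (q • B) (hqsymm n) (hqfin n)
    (half_pos hκ0) (hqco n) (hqn n)
  set M : ℝ := Real.exp ((q * (‖C‖ + 1) / (κ / 2)) ^ 2 / 2 +
    q * (‖C‖ + 1) * (q * (‖C‖ + 1) / (κ / 2))) ^ (1 / 2 : ℝ) *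
    Real.exp (-(q * A) + 1 / 2 * (‖q • B‖ * (‖q • B‖ / (κ / 2)))) with hM
  have hM0 : 0 < M := by positivity
  have hnorm : ∀ n, eLpNorm (fun ω => Real.exp (-quadVar W P A B (K n) ω)) (ENNReal.ofReal q) P ≤
      ENNReal.ofReal (M ^ (1 / q)) := fun n => by
    have hae : (fun ω => Real.exp (-quadVar W P (q * A) (q • B) (q • K n) ω)) =ᵐ[P]
        fun ω => Real.exp (-(q * quadVar W P A B (K n) ω)) := by
      filter_upwards [quadVar_smul hW q A B (K n)] with ω hω
      rw [hω]
    rw [eLpNorm_exp_neg (by linarith) ((hmom n).1.congr hae), ← integral_congr_ae hae]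
    refine ENNReal.ofReal_le_ofReal (Real.rpow_le_rpow ?_ (hmom n).2 (by positivity))
    exact integral_nonneg fun _ => (Real.exp_pos _).le
  obtain ⟨s, hs, hae⟩ := exists_subseq_tendsto_quadVar hW A B hKt
  have hmeas : ∀ L : Kernel2 N,
      AEStronglyMeasurable (fun ω => Real.exp (-quadVar W P A B L ω)) P := fun L =>
    (measurable_quadVar A B L).neg.exp.aestronglyMeasurable
  obtain ⟨hint, hconv⟩ := tendsto_integral_of_eLpNorm_le (fun n => hmeas (K (s n))) (hmeas C) hq1
    (by positivity) (fun n => hnorm (s n)) (by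
      filter_upwards [hae] with ω hω
      exact (Real.continuous_exp.tendsto _).comp hω.neg)
  -- The same expectations, written by the finite rank formula, converge to the right-hand side;
  -- positivity of `det2 C` makes the power continuous there.
  refine ⟨hint, tendsto_nhds_unique hconv ?_⟩
  have hKs : Filter.Tendsto (fun n => K (s n)) Filter.atTop (nhds C) :=
    hKt.comp hs.tendsto_atTop
  have hd : Filter.Tendsto (fun n => rankDet2 (K (s n))) Filter.atTop (nhds (det2 C)) :=
    hlim.comp (tendsto_nhdsWithin_iff.2 ⟨hKs, Filter.Eventually.of_forall fun n => hKfin _⟩)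
  simp only [fun n => integral_exp_neg_quadVar_finiteRank hW A B (hKsymm n) (hKfin n) hε (hco n)]
  refine (hd.rpow_const (Or.inl hdet.ne')).mul ((Real.continuous_exp.tendsto _).comp ?_)
  exact ((tendsto_inner_inverse B (isUnit_of_coercive hε₀ hco₀) hKs).const_mul _).const_add _
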